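/- Let $F$ be a free group and let $R$, $S$ be normal subgroups of $F$, with derived subgroups $R'=[R,R]$ and $S'=[S,S]$. For a normal subgroup $G$ of $F$ let $\mathfrak g$ denote the two-sided ideal of the integral group ring $\mathbb Z[F]$ generated by $\{g-1 : g\in G\}$; thus $\mathfrak r$, $\mathfrak s$, $\mathfrak f$ are the ideals belonging to $R$, $S$ and $F$ itself. For elements $g,h$ of a group write $[g,h]=g^{-1}h^{-1}gh$, and for subgroups $A,B$ let $[A,B]$ be the subgroup generated by all $[a,b]$ with $a\in A$, $b\in B$. Then $$F\cap(1+\mathfrak r\mathfrak f\mathfrak s)=[R'\cap S',\,R\cap S]\,[R'\cap S,\,R'\cap S]\,[R\cap S',\,R\cap S']\,W,$$ where $W$ is the subgroup of $F$ generated by all elements $$[x_1,y]\,[x,y_2]^{-1}$$ such that $x,y\in R\cap S$ and, for some integer $m\ge 2$, $x^m=x_1x_2$ and $y^m=y_1y_2$ with $x_1,y_1\in R'\cap S$ and $x_2,y_2\in R\cap S'$. -/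

import Mathlib

open scoped Pointwise

/-- For a subgroup `G` of `F`, the two-sided ideal of the integral group ring `ℤ[F]` generated by
the elements `g - 1`, `g ∈ G`. -/
noncomputable def groupRingIdeal {F : Type*} [Group F] (G : Subgroup F) :
    Ideal (MonoidAlgebra ℤ F) :=
  (TwoSidedIdeal.span
    {a : MonoidAlgebra ℤ F | ∃ g ∈ G, a = MonoidAlgebra.of ℤ F g - 1}).asIdeal

/-- `F ∩ (1 + 𝔞)`: the elements of `F` whose image in the group ring `ℤ[F]` lies in `1 + 𝔞`. -/
def groupCapOneAdd {F : Type*} [Group F] (a : Ideal (MonoidAlgebra ℤ F)) : Set F :=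
  {g : F | MonoidAlgebra.of ℤ F g - 1 ∈ a}

/-- The commutator of two elements, with the convention `[g, h] = g⁻¹ h⁻¹ g h`. -/
def elemComm {F : Type*} [Group F] (g h : F) : F := g⁻¹ * h⁻¹ * g * h

/-- The subgroup `W` of `F` generated by the elements `[x₁, y] [x, y₂]⁻¹`, where `x, y ∈ R ∩ S`
and, for some `m ≥ 2`, `x ^ m = x₁ x₂` and `y ^ m = y₁ y₂` with `x₁, y₁ ∈ R' ∩ S` and
`x₂, y₂ ∈ R ∩ S'`. Here `R' = ⁅R, R⁆` and `S' = ⁅S, S⁆` are the derived subgroups. -/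
def subgroupW {F : Type*} [Group F] (R S : Subgroup F) : Subgroup F :=
  Subgroup.closure
    {w : F | ∃ (x y x₁ x₂ y₁ y₂ : F) (m : ℕ),
      x ∈ R ⊓ S ∧ y ∈ R ⊓ S ∧ 2 ≤ m ∧
      x ^ m = x₁ * x₂ ∧ y ^ m = y₁ * y₂ ∧
      x₁ ∈ ⁅R, R⁆ ⊓ S ∧ y₁ ∈ ⁅R, R⁆ ⊓ S ∧
      x₂ ∈ R ⊓ ⁅S, S⁆ ∧ y₂ ∈ R ⊓ ⁅S, S⁆ ∧
      w = elemComm x₁ y * (elemComm x y₂)⁻¹}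

/-! ### Right exactness of the tensor product and flatness. -/

section TensorKernel

open TensorProduct

variable {R : Type*} [CommRing R]

/-! Put `D = R ∩ S` and let `K` be the right-hand side, a subgroup because its first three factors
are normal.

`K` lies in `F ∩ (1 + 𝔯𝔣𝔰)`: for `a, b ∈ D`, modulo `𝔯𝔣𝔰`, `[a, b] - 1` is `(a - 1)(b - 1) - (b -
1)(a - 1)`, and `(a - 1)(b - 1)` depends only on the tensor of the classes of `a` in `R_ab` and `b`
in `S_ab`. For a generator of `W` the surviving terms agree since `y ⊗ m x = m y ⊗ x`.

Conversely let `w - 1 ∈ 𝔯𝔣𝔰 ⊆ 𝔯𝔰`. A Fox calculus argument gives `w ∈ D'`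
(`mem_commutator_inf_of_sub_one_mem_mul`). Since `[D', D] ≤ K`, the commutator modulo `K` is an
alternating form `β` on `P = D_ab`, and the class of `w` is `β(t)` for some `t ∈ P ⊗ P`. Fox
derivatives also give a map to `R_ab ⊗ S_ab` that is trivial on `𝔯𝔣𝔰` and sends `w - 1` to the image
of `t - τt`, with `τ` the swap (`exists_addHom_tensor_abelianization`,
`exists_tensor_of_mem_commutator`). So that image vanishes, and `β(t) = 0` remains to be shown.

This is linear algebra over a principal ideal domain (`LinearMap.lift_eq_zero_of_sub_comm_mem`). Let
`U`, `V` be the kernels of `P → R_ab`, `P → S_ab`; these targets are torsion-free, as `R` and `S`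
are free, so `P` may be taken free of finite rank. In a basis `e` adapted to `U + V`, with divisors
`d`, the tensor becomes `t = a + ∑ u_i ⊗ e_i + v` with `a` symmetric, `u_i ∈ U`, `v ∈ V ⊗ P`.
Moreover `u_i ≡ d_i w_i` modulo `V`, and `d_i e_i = p_i + q_i` with `p_i ∈ U`, `q_i ∈ V`. The
relation from `W` with `m = d_i` trades `u_i ⊗ e_i` for `-q_i ⊗ w_i`. What is left lies in `V ⊗ P`
and, by flatness of `P ⧸ V`, in `(U ∩ V) ⊗ P + V ⊗ V`, where `β` vanishes by the first and third
factors of `K`. -/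

theorem TensorProduct.ker_map_eq_map₂ {A B C E : Type*} [AddCommGroup A] [AddCommGroup B]
    [AddCommGroup C] [AddCommGroup E] [Module R A] [Module R B] [Module R C] [Module R E]
    (f : A →ₗ[R] B) (g : C →ₗ[R] E) (hf : Function.Surjective f) (hg : Function.Surjective g) :
    LinearMap.ker (TensorProduct.map f g) =
      Submodule.map₂ (TensorProduct.mk R A C) (LinearMap.ker f) ⊤ ⊔
        Submodule.map₂ (TensorProduct.mk R A C) ⊤ (LinearMap.ker g) := by
  rw [TensorProduct.map_ker (f := (LinearMap.ker f).subtype) (f' := (LinearMap.ker g).subtype)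
    (LinearMap.exact_subtype_ker_map f) hf (LinearMap.exact_subtype_ker_map g) hg,
    LinearMap.lTensor, LinearMap.rTensor, TensorProduct.range_map, TensorProduct.range_map,
    sup_comm]
  simp

variable {P X : Type*} [AddCommGroup P] [Module R P] [AddCommGroup X] [Module R X]

theorem TensorProduct.map_eq_zero_of_mem_sup_map₂ (U V : Submodule R P) (φ : P ⊗[R] P →ₗ[R] X)
    (hU : ∀ u ∈ U, ∀ p, φ (u ⊗ₜ p) = 0) (hV : ∀ v ∈ V, ∀ p, φ (p ⊗ₜ v) = 0) {t : P ⊗[R] P}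
    (ht : t ∈ Submodule.map₂ (TensorProduct.mk R P P) U ⊤ ⊔
      Submodule.map₂ (TensorProduct.mk R P P) ⊤ V) : φ t = 0 := by
  refine SetLike.le_def.1 (sup_le ?_ ?_ : _ ≤ LinearMap.ker φ) ht <;> rw [Submodule.map₂_le]
  · exact fun m hm n _ => hU m hm n
  · exact fun m _ n hn => hV n hn m

/-- If `P ⧸ V` is flat, an element of `V ⊗ P` vanishing in `P ⧸ U ⊗ P ⧸ V` comes from
`(U ⊓ V) ⊗ P` and `V ⊗ V`. -/
theorem TensorProduct.mem_sup_map₂_of_flat_quotient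
    (U V : Submodule R P) [Module.Flat R (P ⧸ V)] {t : P ⊗[R] P}
    (ht : t ∈ Submodule.map₂ (TensorProduct.mk R P P) V ⊤)
    (ht' : t ∈ Submodule.map₂ (TensorProduct.mk R P P) U ⊤ ⊔
      Submodule.map₂ (TensorProduct.mk R P P) ⊤ V) :
    t ∈ Submodule.map₂ (TensorProduct.mk R P P) (U ⊓ V) ⊤ ⊔
      Submodule.map₂ (TensorProduct.mk R P P) V V := by
  have h1 : t ∈ LinearMap.range (TensorProduct.map V.subtype (LinearMap.id : P →ₗ[R] P)) := by
    rw [TensorProduct.range_map]; simpa using ht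
  obtain ⟨s, rfl⟩ := h1
  have h2 : TensorProduct.map U.mkQ V.mkQ (TensorProduct.map V.subtype LinearMap.id s) = 0 := by
    rw [← LinearMap.mem_ker,
      TensorProduct.ker_map_eq_map₂ _ _ U.mkQ_surjective V.mkQ_surjective]
    simpa using ht'
  set q : V →ₗ[R] P ⧸ U := U.mkQ ∘ₗ V.subtype with hq
  -- Flatness of `P ⧸ V` lets `P ⧸ U` be replaced by the image of `V`; the kernel of `V` onto that
  -- image is `U ⊓ V`.
  have h3 : (LinearMap.rTensor (P ⧸ V) (LinearMap.range q).subtype)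
      (TensorProduct.map q.rangeRestrict V.mkQ s) = 0 := by
    rw [← h2, ← LinearMap.comp_apply, ← LinearMap.comp_apply]
    congr 1
    ext v p
    rfl
  have h4 : TensorProduct.map q.rangeRestrict V.mkQ s = 0 :=
    Module.Flat.rTensor_preserves_injective_linearMap (M := P ⧸ V)
      (LinearMap.range q).subtype (Submodule.subtype_injective _) (by rw [h3, map_zero])
  rw [← LinearMap.mem_ker, TensorProduct.ker_map_eq_map₂ _ _ q.surjective_rangeRestrict
    V.mkQ_surjective] at h4
  have h5 := Submodule.mem_map_of_mem (f := TensorProduct.map V.subtype LinearMap.id) h4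
  refine SetLike.le_def.1 ?_ h5
  rw [Submodule.map_sup]
  refine sup_le_sup ?_ ?_
  · rw [Submodule.map_le_iff_le_comap, Submodule.map₂_le]
    intro m hm n _
    refine Submodule.apply_mem_map₂ _ ⟨?_, m.2⟩ trivial
    have : q m = 0 := by simpa using hm
    simpa [hq] using this
  · rw [Submodule.map_le_iff_le_comap, Submodule.map₂_le]
    intro m _ n hn
    exact Submodule.apply_mem_map₂ _ m.2 (by simpa using hn)

end TensorKernel

/-! ### Smith normal form as divisibility of coordinates. -/

section SmithBasis

open Module

/-- A submodule of a finite free module over a principal ideal domain is cut out by divisibility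
conditions on the coordinates with respect to a suitable basis. -/
theorem Submodule.exists_basis_dvd {R P ι : Type*} [CommRing R] [IsDomain R]
    [IsPrincipalIdealRing R] [AddCommGroup P] [Module R P] [Finite ι] (b : Basis ι R P)
    (N : Submodule R P) : ∃ (e : Basis ι R P) (d : ι → R),
      (∀ i, d i • e i ∈ N) ∧ ∀ x ∈ N, ∀ i, d i ∣ e.repr x i := by
  classical
  obtain ⟨n, s⟩ := N.smithNormalForm b
  -- The divisor `0` is right off the Smith embedding: there `N` has zero coordinate, and only `0`
  -- divides just `0`-valued coordinates without adding anything to `N`.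
  refine ⟨s.bM, fun i => if h : ∃ j, s.f j = i then s.a h.choose else 0, ?_, ?_⟩
  · intro i
    by_cases h : ∃ j, s.f j = i
    · have := (s.bN h.choose).2
      rw [s.snf, h.choose_spec] at this
      simpa only [h, dif_pos] using this
    · simp [h]
  · intro x hx i
    by_cases h : ∃ j, s.f j = i
    · simp only [h, dif_pos]
      have := s.repr_apply_embedding_eq_repr_smul (i := h.choose) ⟨x, hx⟩
      rw [h.choose_spec] at this
      simp only at this
      rw [this, map_smul, Finsupp.smul_apply, smul_eq_mul]
      exact dvd_mul_right _ _
    · have := s.repr_eq_zero_of_notMem_range ⟨x, hx⟩ (i := i) h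
      simp only at this
      simp [this]

end SmithBasis

/-! ### Tensors with vanishing antisymmetrization modulo submodules. -/

section Alternating

open TensorProduct

variable {R P : Type*} [CommRing R] [AddCommGroup P] [Module R P]

/-- The swap pairs off the off-diagonal terms. The diagonal needs `h0`, since `2 f i i = 0` is not
enough when there is 2-torsion. -/
theorem Finset.sum_sum_eq_zero_of_antisymm {ι T : Type*} [Fintype ι] [AddCommGroup T]
    (f : ι → ι → T) (h0 : ∀ i, f i i = 0) (h : ∀ i j, f i j + f j i = 0) :
    ∑ i, ∑ j, f i j = 0 := by
  rw [← Finset.sum_product' (s := Finset.univ) (t := Finset.univ)]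
  refine Finset.sum_involution (fun p _ => p.swap) ?_ ?_ ?_ ?_
  · intro p _; exact h _ _
  · rintro ⟨i, j⟩ _ hp h2
    simp only [Prod.swap_prod_mk, Prod.mk.injEq] at h2
    obtain ⟨rfl, _⟩ := h2
    exact hp (h0 _)
  · simp
  · simp

/-- A tensor whose antisymmetrization vanishes in `P ⧸ U ⊗ P ⧸ V` lies in `(U + V) ⊗ P` up to
symmetric tensors. -/
theorem TensorProduct.mem_span_sup_map₂_of_sub_comm_mem {ι : Type*} [Fintype ι]
    (e : Module.Basis ι R P) (d : ι → R) (N U V : Submodule R P) (hUN : U ≤ N) (hVN : V ≤ N)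
    (hd : ∀ i, d i • e i ∈ N) (hN : ∀ x ∈ N, ∀ i, d i ∣ e.repr x i) (t : P ⊗[R] P)
    (ht : t - TensorProduct.comm R P P t ∈ Submodule.map₂ (TensorProduct.mk R P P) U ⊤ ⊔
      Submodule.map₂ (TensorProduct.mk R P P) ⊤ V) :
    t ∈ Submodule.span R {a | ∃ p : P, a = p ⊗ₜ[R] p} ⊔
      Submodule.map₂ (TensorProduct.mk R P P) N ⊤ := by
  classical
  set Y := Submodule.span R {a | ∃ p : P, a = p ⊗ₜ[R] p} ⊔
      Submodule.map₂ (TensorProduct.mk R P P) N ⊤ with hY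
  have hdiag : ∀ p : P, p ⊗ₜ[R] p ∈ Y := fun p =>
    Submodule.mem_sup_left (Submodule.subset_span ⟨p, rfl⟩)
  have hsymm : ∀ p q : P, p ⊗ₜ[R] q + q ⊗ₜ[R] p ∈ Y := by
    intro p q
    have := Y.sub_mem (Y.sub_mem (hdiag (p + q)) (hdiag p)) (hdiag q)
    simp only [TensorProduct.add_tmul, TensorProduct.tmul_add] at this
    convert this using 1
    abel
  have hl : ∀ i j, d i • (e i ⊗ₜ[R] e j) ∈ Y := by
    intro i j
    rw [TensorProduct.smul_tmul']
    exact Submodule.mem_sup_right (Submodule.apply_mem_map₂ _ (hd i) trivial)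
  have hr : ∀ i j, d j • (e i ⊗ₜ[R] e j) ∈ Y := by
    intro i j
    have := Y.sub_mem (Y.smul_mem (d j) (hsymm (e i) (e j))) (hl j i)
    rwa [smul_add, add_sub_cancel_right] at this
  set c : ι → ι → (P ⊗[R] P) →ₗ[R] R := fun i j =>
    TensorProduct.lift ((LinearMap.mul R R).compl₁₂ (e.coord i) (e.coord j)) with hc
  have hct : ∀ i j p q, c i j (p ⊗ₜ q) = e.repr p i * e.repr q j := by
    intro i j p q; rfl
  have hexp : ∀ s : P ⊗[R] P, s = ∑ i, ∑ j, c i j s • (e i ⊗ₜ[R] e j) := by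
    intro s
    induction s with
    | zero => simp
    | add x y hx hy =>
      simp only [map_add, add_smul, Finset.sum_add_distrib]
      rw [← hx, ← hy]
    | tmul p q =>
      conv_lhs => rw [← e.sum_repr p, ← e.sum_repr q]
      simp only [TensorProduct.sum_tmul, TensorProduct.tmul_sum, hct]
      rw [Finset.sum_comm]
      refine Finset.sum_congr rfl fun i _ => Finset.sum_congr rfl fun j _ => ?_
      rw [TensorProduct.tmul_smul, ← TensorProduct.smul_tmul', smul_smul, mul_comm]
  have hcc : ∀ i j (s : P ⊗[R] P), c i j (TensorProduct.comm R P P s) = c j i s := by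
    intro i j s
    induction s with
    | zero => simp
    | add x y hx hy => simp only [map_add, hx, hy]
    | tmul p q => rw [TensorProduct.comm_tmul, hct, hct, mul_comm]
  -- Modulo `(d i, d j)` the functional `c i j` kills `U ⊗ P` and `P ⊗ V`, so the difference is a
  -- combination of `d i` and `d j`, and both multiples of `e i ⊗ e j` lie in `Y`.
  have hmul : ∀ i j, (c i j t - c j i t) • (e i ⊗ₜ[R] e j) ∈ Y := by
    intro i j
    have h0 := TensorProduct.map_eq_zero_of_mem_sup_map₂ U V
      ((Submodule.mkQ (Ideal.span {d i, d j} : Submodule R R)) ∘ₗ c i j) ?_ ?_ ht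
    · rw [LinearMap.comp_apply, Submodule.mkQ_apply, Submodule.Quotient.mk_eq_zero,
        map_sub, hcc, Ideal.mem_span_pair] at h0
      obtain ⟨a, b, hab⟩ := h0
      have := Y.add_mem (Y.smul_mem a (hl i j)) (Y.smul_mem b (hr i j))
      rwa [smul_smul, smul_smul, ← add_smul, hab] at this
    all_goals
      intro m hm n
      rw [LinearMap.comp_apply, Submodule.mkQ_apply, Submodule.Quotient.mk_eq_zero, hct]
    · exact Ideal.mul_mem_right _ _ (Ideal.mem_of_dvd _ (hN m (hUN hm) i)
        (Ideal.subset_span (by simp)))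
    · exact Ideal.mul_mem_left _ _ (Ideal.mem_of_dvd _ (hN m (hVN hm) j)
        (Ideal.subset_span (by simp)))
  -- Modulo `Y`, both `e i ⊗ e j` and its coefficient difference behave antisymmetrically, so the
  -- expansion cancels in pairs.
  rw [← Submodule.Quotient.mk_eq_zero, ← Submodule.mkQ_apply, hexp t]
  simp only [map_sum]
  apply Finset.sum_sum_eq_zero_of_antisymm
  · intro i
    rw [map_smul, Submodule.mkQ_apply, (Submodule.Quotient.mk_eq_zero Y).2 (hdiag _), smul_zero]
  · intro i j
    rw [← map_add, Submodule.mkQ_apply, Submodule.Quotient.mk_eq_zero]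
    have := Y.add_mem (hmul i j) (Y.smul_mem (c j i t) (hsymm (e i) (e j)))
    convert this using 1
    rw [sub_smul, smul_add]
    abel

end Alternating

/-! ### The linear algebra core: the alternating form kills the tensor. -/

section AlternatingCore

open TensorProduct

variable {R P T ι : Type*} [CommRing R] [AddCommGroup P] [Module R P]

theorem TensorProduct.exists_sum_tmul_basis_of_mem_map₂ [Fintype ι] (e : Module.Basis ι R P)
    (U : Submodule R P) {t : P ⊗[R] P}
    (ht : t ∈ Submodule.map₂ (TensorProduct.mk R P P) U ⊤) :
    ∃ u : ι → P, (∀ i, u i ∈ U) ∧ t = ∑ i, u i ⊗ₜ[R] e i := by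
  let L : (ι → U) →ₗ[R] P ⊗[R] P :=
    ∑ i, ((TensorProduct.mk R P P).flip (e i)) ∘ₗ U.subtype ∘ₗ LinearMap.proj i
  have hL : ∀ u : ι → U, L u = ∑ i, (u i : P) ⊗ₜ[R] e i := by
    intro u; simp [L]
  have h : Submodule.map₂ (TensorProduct.mk R P P) U ⊤ ≤ LinearMap.range L := by
    rw [Submodule.map₂_le]
    intro m hm n _
    refine ⟨fun i => e.repr n i • ⟨m, hm⟩, ?_⟩
    rw [hL, TensorProduct.mk_apply]
    conv_rhs => rw [← e.sum_repr n]
    rw [TensorProduct.tmul_sum]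
    refine Finset.sum_congr rfl fun i _ => ?_
    rw [TensorProduct.tmul_smul, TensorProduct.smul_tmul']
    rfl
  obtain ⟨u, rfl⟩ := h ht
  exact ⟨fun i => u i, fun i => (u i).2, hL u⟩

theorem TensorProduct.comm_eq_self_of_mem_span_tmul_self {a : P ⊗[R] P}
    (ha : a ∈ Submodule.span R {a | ∃ p : P, a = p ⊗ₜ[R] p}) :
    TensorProduct.comm R P P a = a := by
  induction ha using Submodule.span_induction with
  | mem x hx => obtain ⟨p, rfl⟩ := hx; simp
  | zero => simp
  | add x y _ _ hx hy => rw [map_add, hx, hy]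
  | smul c x _ hx => rw [map_smul, hx]

theorem TensorProduct.comm_mem_map₂ {U V : Submodule R P} {t : P ⊗[R] P}
    (ht : t ∈ Submodule.map₂ (TensorProduct.mk R P P) U V) :
    TensorProduct.comm R P P t ∈ Submodule.map₂ (TensorProduct.mk R P P) V U := by
  have h : Submodule.map₂ (TensorProduct.mk R P P) U V ≤
      (Submodule.map₂ (TensorProduct.mk R P P) V U).comap
        (TensorProduct.comm R P P).toLinearMap := by
    rw [Submodule.map₂_le]
    exact fun m hm n hn => Submodule.apply_mem_map₂ _ hn hm
  exact h ht

variable [AddCommGroup T] [Module R T]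

/-- If `u_j ∈ U` and `∑ u_j ⊗ e_j` has, modulo symmetric tensors and `V ⊗ P`, vanishing
antisymmetrization in `P ⧸ U ⊗ P ⧸ V`, then each `u_i` is divisible by `d_i` modulo `V`. -/
theorem TensorProduct.mem_smul_sup_of_sub_comm_mem [Fintype ι] (e : Module.Basis ι R P)
    (U V : Submodule R P) (i : ι) (d : R) (hU : ∀ x ∈ U, d ∣ e.repr x i)
    (hV : ∀ x ∈ V, d ∣ e.repr x i) {a v : P ⊗[R] P} {u : ι → P} (hu : ∀ i, u i ∈ U)
    (ha : a ∈ Submodule.span R {a | ∃ p : P, a = p ⊗ₜ[R] p})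
    (hv : v ∈ Submodule.map₂ (TensorProduct.mk R P P) V ⊤)
    (ht : (a + (∑ j, u j ⊗ₜ[R] e j + v)) -
      TensorProduct.comm R P P (a + (∑ j, u j ⊗ₜ[R] e j + v)) ∈
      Submodule.map₂ (TensorProduct.mk R P P) U ⊤ ⊔
      Submodule.map₂ (TensorProduct.mk R P P) ⊤ V) :
    ∃ w, ∃ v' ∈ V, u i = d • w + v' := by
  classical
  set Z : Submodule R P := LinearMap.range (LinearMap.lsmul R P d) ⊔ V with hZ
  -- `φ` takes the `i`-th coordinate on the left and reduces the right factor modulo `d P + V`.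
  -- Among the terms of `ht` it sees only the swap of `∑ u j ⊗ e j`, from which it extracts `u i`.
  set φ : P ⊗[R] P →ₗ[R] P ⧸ Z :=
    TensorProduct.lift ((LinearMap.lsmul R (P ⧸ Z)).compl₁₂ (e.coord i) Z.mkQ) with hφ
  have hφt : ∀ p q, φ (p ⊗ₜ q) = e.repr p i • Z.mkQ q := fun p q => rfl
  have hdvd : ∀ p, d ∣ e.repr p i → ∀ q, φ (p ⊗ₜ q) = 0 := by
    rintro p ⟨k, hk⟩ q
    rw [hφt, hk, ← map_smul, Submodule.mkQ_apply, Submodule.Quotient.mk_eq_zero, mul_smul]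
    exact Submodule.mem_sup_left ⟨k • q, rfl⟩
  have hφV : ∀ x ∈ V, ∀ p, φ (p ⊗ₜ x) = 0 := by
    intro x hx p
    rw [hφt, Submodule.mkQ_apply, (Submodule.Quotient.mk_eq_zero _).2
      (Submodule.mem_sup_right hx), smul_zero]
  have h1 := TensorProduct.map_eq_zero_of_mem_sup_map₂ U V φ (fun x hx => hdvd x (hU x hx)) hφV ht
  have hv1 : φ v = 0 := TensorProduct.map_eq_zero_of_mem_sup_map₂ V V φ
    (fun x hx => hdvd x (hV x hx)) hφV (Submodule.mem_sup_left hv)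
  have hv2 : φ (TensorProduct.comm R P P v) = 0 := TensorProduct.map_eq_zero_of_mem_sup_map₂ V V φ
    (fun x hx => hdvd x (hV x hx)) hφV (Submodule.mem_sup_right (TensorProduct.comm_mem_map₂ hv))
  have hs : φ (∑ j, u j ⊗ₜ[R] e j) = 0 := by
    rw [map_sum]
    exact Finset.sum_eq_zero fun j _ => hdvd _ (hU _ (hu j)) _
  have hs2 : φ (TensorProduct.comm R P P (∑ j, u j ⊗ₜ[R] e j)) = Z.mkQ (u i) := by
    rw [map_sum, map_sum, Finset.sum_eq_single i]
    · rw [TensorProduct.comm_tmul, hφt]; simp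
    · intro j _ hj
      rw [TensorProduct.comm_tmul, hφt]; simp [hj]
    · simp
  rw [map_sub, map_add, map_add, map_add, map_add, map_add, map_add, hv1, hv2, hs, hs2,
    TensorProduct.comm_eq_self_of_mem_span_tmul_self ha] at h1
  have h2 : Z.mkQ (u i) = 0 := by simpa using h1
  rw [Submodule.mkQ_apply, Submodule.Quotient.mk_eq_zero, hZ, Submodule.mem_sup] at h2
  obtain ⟨_, ⟨w, rfl⟩, v', hv', h3⟩ := h2
  exact ⟨w, v', hv', h3.symm⟩

/-- Let `β` be an alternating form on a finite free module `P` over a principal ideal domain,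
with `β x₁ y = β x y₂` whenever `m x = x₁ + x₂` and `m y = y₁ + y₂` with `x₁, y₁ ∈ U` and
`x₂, y₂ ∈ V` (so that `β` vanishes on `(U ⊓ V) × P`, `U × U` and `V × V`). Then `β` kills every
tensor whose antisymmetrization vanishes in `P ⧸ U ⊗ P ⧸ V`. -/
theorem LinearMap.lift_eq_zero_of_sub_comm_mem [IsDomain R] [IsPrincipalIdealRing R] [Finite ι]
    (b : Module.Basis ι R P) (U V : Submodule R P) [Module.Flat R (P ⧸ V)]
    (β : P →ₗ[R] P →ₗ[R] T) (halt : ∀ p, β p p = 0)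
    (hW : ∀ (m : R) (x y x₁ x₂ y₁ y₂ : P), x₁ ∈ U → y₁ ∈ U → x₂ ∈ V → y₂ ∈ V →
      m • x = x₁ + x₂ → m • y = y₁ + y₂ → β x₁ y = β x y₂)
    (t : P ⊗[R] P)
    (ht : t - TensorProduct.comm R P P t ∈ Submodule.map₂ (TensorProduct.mk R P P) U ⊤ ⊔
      Submodule.map₂ (TensorProduct.mk R P P) ⊤ V) :
    TensorProduct.lift β t = 0 := by
  have := Fintype.ofFinite ι
  obtain ⟨e, d, hd, hN⟩ := (U ⊔ V).exists_basis_dvd b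
  obtain ⟨a, ha, n, hn, rfl⟩ := Submodule.mem_sup.1
    (TensorProduct.mem_span_sup_map₂_of_sub_comm_mem e d (U ⊔ V) U V le_sup_left le_sup_right
      hd hN t ht)
  rw [Submodule.map₂_sup_left] at hn
  obtain ⟨n', hn', v, hv, rfl⟩ := Submodule.mem_sup.1 hn
  obtain ⟨u, hu, rfl⟩ := TensorProduct.exists_sum_tmul_basis_of_mem_map₂ e U hn'
  have hw : ∀ i, ∃ w, ∃ v' ∈ V, u i = d i • w + v' := fun i =>
    TensorProduct.mem_smul_sup_of_sub_comm_mem e U V i (d i)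
      (fun x hx => hN x (Submodule.mem_sup_left hx) i)
      (fun x hx => hN x (Submodule.mem_sup_right hx) i) hu ha hv ht
  choose w v' hv' huw using hw
  have hpq : ∀ i, ∃ p ∈ U, ∃ q ∈ V, p + q = d i • e i := fun i => Submodule.mem_sup.1 (hd i)
  choose p hp q hq hpq using hpq
  set Y := Submodule.map₂ (TensorProduct.mk R P P) U ⊤ ⊔
    Submodule.map₂ (TensorProduct.mk R P P) ⊤ V with hY
  have hUY : ∀ x ∈ U, ∀ y, x ⊗ₜ[R] y ∈ Y := fun x hx y =>
    Submodule.mem_sup_left (Submodule.apply_mem_map₂ _ hx trivial)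
  have hVY : ∀ x ∈ V, ∀ y, y ⊗ₜ[R] x ∈ Y := fun x hx y =>
    Submodule.mem_sup_right (Submodule.apply_mem_map₂ _ trivial hx)
  -- Each `u i ⊗ e i` is traded for `-q i ⊗ w i`: the value of `β` is unchanged by `hW`, and the new
  -- tensor lies in `V ⊗ P`.
  set t' := v - ∑ i, q i ⊗ₜ[R] w i with ht'
  have ht'V : t' ∈ Submodule.map₂ (TensorProduct.mk R P P) V ⊤ :=
    sub_mem hv (sum_mem fun i _ => Submodule.apply_mem_map₂ _ (hq i) trivial)
  have hcomm : TensorProduct.comm R P P t' ∈ Y :=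
    Submodule.mem_sup_right (TensorProduct.comm_mem_map₂ ht'V)
  have hterm : ∑ i, ((u i ⊗ₜ[R] e i + q i ⊗ₜ[R] w i) - (e i ⊗ₜ[R] u i + w i ⊗ₜ[R] q i)) ∈ Y := by
    refine sum_mem fun i _ => ?_
    have h1 : e i ⊗ₜ[R] u i = p i ⊗ₜ[R] w i + q i ⊗ₜ[R] w i + e i ⊗ₜ[R] v' i := by
      conv_lhs => rw [huw i, TensorProduct.tmul_add, TensorProduct.tmul_smul,
        TensorProduct.smul_tmul', ← hpq i, TensorProduct.add_tmul]
    have h2 : (u i ⊗ₜ[R] e i + q i ⊗ₜ[R] w i) - (e i ⊗ₜ[R] u i + w i ⊗ₜ[R] q i) =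
        u i ⊗ₜ[R] e i - p i ⊗ₜ[R] w i - e i ⊗ₜ[R] v' i - w i ⊗ₜ[R] q i := by
      rw [h1]; abel
    rw [h2]
    exact Y.sub_mem (Y.sub_mem (Y.sub_mem (hUY _ (hu i) _) (hUY _ (hp i) _))
      (hVY _ (hv' i) _)) (hVY _ (hq i) _)
  -- The trade changes the antisymmetrization only inside `Y`, and the swap of `t'` is already in `P
  -- ⊗ V`.
  have ht'Y : t' ∈ Y := by
    have h1 := Y.add_mem (Y.sub_mem ht hterm) hcomm
    convert h1 using 1
    simp only [map_add, map_sub, map_sum, TensorProduct.comm_tmul, ht',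
      TensorProduct.comm_eq_self_of_mem_span_tmul_self ha, Finset.sum_sub_distrib,
      Finset.sum_add_distrib]
    abel
  have hanti : ∀ x y, β x y = - β y x := by
    intro x y
    have h1 := halt (x + y)
    simp only [map_add, LinearMap.add_apply, halt, zero_add, add_zero] at h1
    exact eq_neg_of_add_eq_zero_right h1
  have hβ' : TensorProduct.lift β t' = 0 := by
    have h1 := TensorProduct.mem_sup_map₂_of_flat_quotient U V ht'V ht'Y
    refine SetLike.le_def.1 (sup_le ?_ ?_ : _ ≤ LinearMap.ker (TensorProduct.lift β)) h1 <;>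
      rw [Submodule.map₂_le]
    · intro m hm n _
      -- The relation with `m = 0` kills `(U ⊓ V) × P`; below, with `m = 1`, it kills `V × V`.
      have := hW 0 0 n m (-m) 0 0 hm.1 U.zero_mem (neg_mem hm.2) V.zero_mem (by simp) (by simp)
      simpa using this
    · intro m hm n hn
      have := hW 1 m n 0 m 0 n U.zero_mem U.zero_mem hm hn (by simp) (by simp)
      simpa using this.symm
  have hβa : TensorProduct.lift β a = 0 := by
    refine SetLike.le_def.1 (Submodule.span_le.2 ?_ : _ ≤ LinearMap.ker (TensorProduct.lift β)) ha
    rintro _ ⟨p, rfl⟩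
    exact halt p
  have hβu : ∀ i, β (u i) (e i) = - β (q i) (w i) := by
    intro i
    rw [← hanti]
    refine hW (d i) (w i) (e i) (u i) (- v' i) (p i) (q i) (hu i) (hp i) (neg_mem (hv' i)) (hq i)
      ?_ (hpq i).symm
    rw [huw i]; abel
  rw [map_add, map_add, hβa, map_sum, zero_add, ← hβ', ht', map_sub, map_sum]
  simp only [TensorProduct.lift.tmul, hβu, Finset.sum_neg_distrib]
  abel

/-- The version of `LinearMap.lift_eq_zero_of_sub_comm_mem` for an arbitrary module `P`, with `U`
and `V` the kernels of linear maps to torsion-free modules. -/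
theorem LinearMap.lift_eq_zero_of_map_sub_comm_eq_zero {M N : Type*} [IsDomain R]
    [IsPrincipalIdealRing R] [AddCommGroup M] [Module R M] [AddCommGroup N] [Module R N]
    [Module.IsTorsionFree R M] [Module.IsTorsionFree R N] (ρ : P →ₗ[R] M) (σ : P →ₗ[R] N)
    (β : P →ₗ[R] P →ₗ[R] T) (halt : ∀ p, β p p = 0)
    (hW : ∀ (m : R) (x y x₁ x₂ y₁ y₂ : P), ρ x₁ = 0 → ρ y₁ = 0 → σ x₂ = 0 → σ y₂ = 0 →
      m • x = x₁ + x₂ → m • y = y₁ + y₂ → β x₁ y = β x y₂)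
    (t : P ⊗[R] P) (ht : TensorProduct.map ρ σ (t - TensorProduct.comm R P P t) = 0) :
    TensorProduct.lift β t = 0 := by
  obtain ⟨n, a, b, rfl⟩ : ∃ (n : ℕ) (a b : Fin n → P), t = ∑ k, a k ⊗ₜ[R] b k :=
    TensorProduct.exists_sum_tmul_eq t
  let π : (Fin n ⊕ Fin n → R) →ₗ[R] P := Fintype.linearCombination R (Sum.elim a b)
  have hπ : ∀ i, π (Pi.single i 1) = Sum.elim a b i := by
    intro i; simp [π]
  -- One free generator for each vector occurring in `t`, so that `t₀` lifts `t`.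
  let t₀ : (Fin n ⊕ Fin n → R) ⊗[R] (Fin n ⊕ Fin n → R) :=
    ∑ k, Pi.single (Sum.inl k) 1 ⊗ₜ[R] Pi.single (Sum.inr k) 1
  -- Torsion-free modules over a principal ideal domain are flat, so vanishing in `M ⊗ N` can be
  -- tested in the tensor product of the images.
  have hf : Function.Injective (TensorProduct.map (LinearMap.range (ρ ∘ₗ π)).subtype
      (LinearMap.range (σ ∘ₗ π)).subtype) := by
    rw [← LinearMap.lTensor_comp_rTensor]
    exact (Module.Flat.lTensor_preserves_injective_linearMap _
      (Submodule.subtype_injective _)).comp (Module.Flat.rTensor_preserves_injective_linearMap _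
      (Submodule.subtype_injective _))
  have hflat : Module.Flat R ((Fin n ⊕ Fin n → R) ⧸ LinearMap.ker (σ ∘ₗ π)) :=
    Module.Flat.of_linearEquiv (LinearMap.quotKerEquivRange (σ ∘ₗ π))
  have h0 := LinearMap.lift_eq_zero_of_sub_comm_mem (Pi.basisFun R (Fin n ⊕ Fin n))
    (LinearMap.ker (ρ ∘ₗ π)) (LinearMap.ker (σ ∘ₗ π)) (β.compl₁₂ π π) (fun p => halt _)
    (fun m x y x₁ x₂ y₁ y₂ h₁ h₂ h₃ h₄ hx hy => hW m _ _ _ (π x₂) (π y₁) _ h₁ h₂ h₃ h₄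
      (by rw [← map_smul, hx, map_add]) (by rw [← map_smul, hy, map_add])) t₀ ?_
  · rw [← h0]
    simp [t₀, hπ]
  · have hs := TensorProduct.ker_map_eq_map₂ (ρ ∘ₗ π).rangeRestrict (σ ∘ₗ π).rangeRestrict
      (LinearMap.surjective_rangeRestrict _) (LinearMap.surjective_rangeRestrict _)
    rw [LinearMap.ker_rangeRestrict, LinearMap.ker_rangeRestrict] at hs
    rw [← hs, LinearMap.mem_ker]
    apply hf
    rw [map_zero, ← ht, ← LinearMap.comp_apply, ← TensorProduct.map_comp]
    simp [t₀, hπ, LinearMap.subtype_comp_codRestrict]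

end AlternatingCore

/-! ### Free groups: crossed homomorphisms and abelianizations. -/

section FreeGroups

theorem IsFreeGroup.closure_range_of_eq_top (G : Type*) [Group G] [IsFreeGroup G] :
    Subgroup.closure (Set.range (IsFreeGroup.of : IsFreeGroup.Generators G → G)) = ⊤ := by
  set H := Subgroup.closure (Set.range (IsFreeGroup.of : IsFreeGroup.Generators G → G)) with hH
  let f : G →* H := IsFreeGroup.lift fun j => ⟨IsFreeGroup.of j, Subgroup.subset_closure ⟨j, rfl⟩⟩
  have hf : H.subtype.comp f = MonoidHom.id G := by
    apply IsFreeGroup.ext_hom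
    intro j
    simp [f, IsFreeGroup.lift_of]
  rw [eq_top_iff]
  intro g _
  have : H.subtype (f g) = g := DFunLike.congr_fun hf g
  rw [← this]
  exact (f g).2

/-- A crossed homomorphism on a free group exists with prescribed values on a basis. -/
theorem IsFreeGroup.exists_crossedHom {G A M : Type*} [Group G] [IsFreeGroup G] [Ring A]
    [AddCommGroup M] [Module A M] (ρ : G →* A) (v : IsFreeGroup.Generators G → M) :
    ∃ δ : G → M, (∀ a b, δ (a * b) = δ a + ρ a • δ b) ∧ ∀ j, δ (IsFreeGroup.of j) = v j := by
  have hinv : ∀ g, ρ g⁻¹ * ρ g = 1 := fun g => by rw [← map_mul, inv_mul_cancel, map_one]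
  have hinv' : ∀ g, ρ g * ρ g⁻¹ = 1 := fun g => by rw [← map_mul, mul_inv_cancel, map_one]
  -- A crossed homomorphism is the orbit of `0` under an affine action with linear part `ρ`, and the
  -- action can be prescribed on generators.
  let aff : IsFreeGroup.Generators G → Equiv.Perm M := fun j =>
    { toFun := fun m => ρ (IsFreeGroup.of j) • m + v j
      invFun := fun m => ρ (IsFreeGroup.of j)⁻¹ • (m - v j)
      left_inv := fun m => by
        beta_reduce
        rw [add_sub_cancel_right, smul_smul, hinv, one_smul]
      right_inv := fun m => by
        beta_reduce
        rw [smul_smul, hinv', one_smul, sub_add_cancel] }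
  let L : G →* Equiv.Perm M := IsFreeGroup.lift aff
  have hL : ∀ g m, L g m = ρ g • m + L g 0 := by
    intro g
    have hg : g ∈ Subgroup.closure (Set.range (IsFreeGroup.of : IsFreeGroup.Generators G → G)) := by
      rw [IsFreeGroup.closure_range_of_eq_top]; trivial
    induction hg using Subgroup.closure_induction with
    | mem x hx =>
      obtain ⟨j, rfl⟩ := hx
      intro m
      simp [L, IsFreeGroup.lift_of, aff]
    | one => intro m; simp
    | mul x y _ _ hx hy =>
      intro m
      rw [map_mul, Equiv.Perm.mul_apply, Equiv.Perm.mul_apply, hx, hy, hx (L y 0), map_mul,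
        smul_add, mul_smul]
      abel
    | inv x _ hx =>
      intro m
      have key : ∀ n, L x⁻¹ n = ρ x⁻¹ • (n - L x 0) := by
        intro n
        rw [map_inv, Equiv.Perm.inv_eq_iff_eq, hx, smul_smul, hinv', one_smul, sub_add_cancel]
      rw [key, key 0, smul_sub, smul_sub, smul_zero]
      abel
  refine ⟨fun g => L g 0, fun a b => ?_, fun j => ?_⟩
  · change L (a * b) 0 = L a 0 + ρ a • L b 0
    rw [map_mul, Equiv.Perm.mul_apply, hL, add_comm]
  · simp [L, IsFreeGroup.lift_of, aff]

theorem IsFreeGroup.isTorsionFree_abelianization (G : Type*) [Group G] [IsFreeGroup G] :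
    Module.IsTorsionFree ℤ (Additive (Abelianization G)) := by
  let b : Module.Basis (IsFreeGroup.Generators G) ℤ (Additive (Abelianization G)) :=
    (FreeAbelianGroup.basis (IsFreeGroup.Generators G)).map
      (MulEquiv.toAdditive (IsFreeGroup.mulEquiv G).abelianizationCongr).toIntLinearEquiv
  have := Module.Free.of_basis b
  infer_instance

end FreeGroups

/-! ### Integral group rings and the ideals of normal subgroups. -/

section IntegralGroupRing

variable {F : Type*} [Group F]

/-- The additive map on the integral group ring extending a function on the group. -/
noncomputable def MonoidAlgebra.intLift {A : Type*} [AddCommGroup A] (f : F → A) :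
    MonoidAlgebra ℤ F →+ A :=
  (Finsupp.liftAddHom fun g => zmultiplesHom A (f g)).comp
    MonoidAlgebra.coeffAddEquiv.toAddMonoidHom

@[simp]
theorem MonoidAlgebra.intLift_of {A : Type*} [AddCommGroup A] (f : F → A) (g : F) :
    MonoidAlgebra.intLift f (MonoidAlgebra.of ℤ F g) = f g := by
  change Finsupp.liftAddHom (fun g => zmultiplesHom A (f g)) (Finsupp.single g 1) = f g
  simp

theorem MonoidAlgebra.int_addHom_ext {A : Type*} [AddCommGroup A] {f g : MonoidAlgebra ℤ F →+ A}
    (h : ∀ x, f (MonoidAlgebra.of ℤ F x) = g (MonoidAlgebra.of ℤ F x)) (α : MonoidAlgebra ℤ F) :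
    f α = g α := by
  suffices f = g by rw [this]
  apply MonoidAlgebra.addMonoidHom_ext
  intro x n
  have : MonoidAlgebra.single x n = n • MonoidAlgebra.of ℤ F x := by
    rw [MonoidAlgebra.of_apply, MonoidAlgebra.smul_single]; simp
  rw [this, map_zsmul, map_zsmul, h]

theorem MonoidAlgebra.int_mem_addSubgroup {B : AddSubgroup (MonoidAlgebra ℤ F)}
    (h : ∀ x, MonoidAlgebra.of ℤ F x ∈ B) (α : MonoidAlgebra ℤ F) : α ∈ B := by
  rw [← QuotientAddGroup.eq_zero_iff]
  exact MonoidAlgebra.int_addHom_ext (f := QuotientAddGroup.mk' B) (g := 0)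
    (fun x => (QuotientAddGroup.eq_zero_iff _).2 (h x)) α

/-- The augmentation of the integral group ring. -/
noncomputable def MonoidAlgebra.intAug (F : Type*) [Group F] : MonoidAlgebra ℤ F →ₐ[ℤ] ℤ :=
  MonoidAlgebra.lift ℤ ℤ F 1

@[simp]
theorem MonoidAlgebra.intAug_of (g : F) :
    MonoidAlgebra.intAug F (MonoidAlgebra.of ℤ F g) = 1 := by
  simp [MonoidAlgebra.intAug]

/-- By normality `g (x - 1) = (g x g⁻¹ - 1) g`, so left multipliers can be moved to the right and
the ideal is additively generated by the `(x - 1) γ`. -/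
theorem groupRingIdeal_le_of_mul_mem {G : Subgroup F} [hG : G.Normal]
    {B : AddSubgroup (MonoidAlgebra ℤ F)}
    (h : ∀ x ∈ G, ∀ γ, (MonoidAlgebra.of ℤ F x - 1) * γ ∈ B) {α : MonoidAlgebra ℤ F}
    (hα : α ∈ groupRingIdeal G) : α ∈ B := by
  rw [groupRingIdeal, TwoSidedIdeal.mem_asIdeal,
    TwoSidedIdeal.mem_span_iff_mem_addSubgroup_closure] at hα
  refine AddSubgroup.closure_le B |>.2 ?_ hα
  rintro _ ⟨_, ⟨β, -, _, ⟨x, hx, rfl⟩, rfl⟩, γ, -, rfl⟩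
  refine MonoidAlgebra.int_mem_addSubgroup
    (B := B.comap ((AddMonoidHom.mulRight γ).comp
      (AddMonoidHom.mulRight (MonoidAlgebra.of ℤ F x - 1)))) (fun g => ?_) β
  have := h (g * x * g⁻¹) (hG.conj_mem x hx g) (MonoidAlgebra.of ℤ F g * γ)
  rw [← mul_assoc, sub_mul, ← map_mul, inv_mul_cancel_right, one_mul] at this
  simpa [mul_sub, ← map_mul] using this

theorem groupRingIdeal_le_of_mem_mul {G : Subgroup F} [hG : G.Normal]
    {B : AddSubgroup (MonoidAlgebra ℤ F)}
    (h : ∀ x ∈ G, ∀ γ, γ * (MonoidAlgebra.of ℤ F x - 1) ∈ B) {α : MonoidAlgebra ℤ F}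
    (hα : α ∈ groupRingIdeal G) : α ∈ B := by
  rw [groupRingIdeal, TwoSidedIdeal.mem_asIdeal,
    TwoSidedIdeal.mem_span_iff_mem_addSubgroup_closure] at hα
  refine AddSubgroup.closure_le B |>.2 ?_ hα
  rintro _ ⟨_, ⟨β, -, _, ⟨x, hx, rfl⟩, rfl⟩, γ, -, rfl⟩
  refine MonoidAlgebra.int_mem_addSubgroup
    (B := B.comap (AddMonoidHom.mulLeft (β * (MonoidAlgebra.of ℤ F x - 1)))) (fun g => ?_) γ
  have := h (g⁻¹ * x * g) (by simpa using hG.conj_mem x hx g⁻¹) (β * MonoidAlgebra.of ℤ F g)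
  rw [mul_assoc, mul_sub, ← map_mul, ← mul_assoc, mul_inv_cancel_left, mul_one, map_mul] at this
  simpa [mul_sub, sub_mul, mul_assoc] using this

theorem Ideal.mul_le_addSubgroup {A : Type*} [Ring A] {I J : Ideal A} {B : AddSubgroup A}
    (h : ∀ a ∈ I, ∀ b ∈ J, a * b ∈ B) {x : A} (hx : x ∈ I * J) : x ∈ B :=
  Submodule.smul_induction_on hx (fun a ha b hb => h a ha b hb) fun _ _ => B.add_mem

theorem of_sub_one_mem_groupRingIdeal {G : Subgroup F} {g : F} (hg : g ∈ G) :
    MonoidAlgebra.of ℤ F g - 1 ∈ groupRingIdeal G :=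
  TwoSidedIdeal.mem_asIdeal.2 (TwoSidedIdeal.subset_span ⟨g, hg, rfl⟩)

instance groupRingIdeal_isTwoSided (G : Subgroup F) : (groupRingIdeal G).IsTwoSided := by
  unfold groupRingIdeal; infer_instance

theorem intAug_eq_zero_of_mem_groupRingIdeal {G : Subgroup F} [G.Normal] {α : MonoidAlgebra ℤ F}
    (hα : α ∈ groupRingIdeal G) : MonoidAlgebra.intAug F α = 0 := by
  refine groupRingIdeal_le_of_mul_mem
    (B := (MonoidAlgebra.intAug F).toRingHom.toAddMonoidHom.ker) (fun x _ γ => ?_) hα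
  change MonoidAlgebra.intAug F _ = 0
  rw [map_mul, map_sub, MonoidAlgebra.intAug_of, map_one, sub_self, zero_mul]

/-- The map to the group ring of `F ⧸ G` kills the ideal, and group elements are distinct there. -/
theorem mem_of_of_sub_one_mem_groupRingIdeal {G : Subgroup F} [G.Normal] {g : F}
    (hg : MonoidAlgebra.of ℤ F g - 1 ∈ groupRingIdeal G) : g ∈ G := by
  let φ := MonoidAlgebra.mapDomainRingHom ℤ (QuotientGroup.mk' G)
  have hφ : ∀ x, φ (MonoidAlgebra.of ℤ F x) = MonoidAlgebra.of ℤ (F ⧸ G) (x : F ⧸ G) := by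
    intro x; simp [φ]
  have h := groupRingIdeal_le_of_mul_mem (B := φ.toAddMonoidHom.ker) (fun x hx γ => ?_) hg
  · change φ _ = 0 at h
    rw [map_sub, hφ, map_one, sub_eq_zero, ← map_one (MonoidAlgebra.of ℤ (F ⧸ G))] at h
    exact (QuotientGroup.eq_one_iff g).1 (MonoidAlgebra.of_injective h)
  · change φ _ = 0
    rw [map_mul, map_sub, hφ, (QuotientGroup.eq_one_iff x).2 hx, map_one, map_one, sub_self,
      zero_mul]

end IntegralGroupRing

/-! ### Extending maps from a subgroup along coset representatives. -/

section CosetExtension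

/-- The class of a group element in the additively written abelianization. -/
def Abelianization.addOf {G : Type*} [Group G] (x : G) : Additive (Abelianization G) :=
  Additive.ofMul (Abelianization.of x)

theorem Abelianization.addOf_mul {G : Type*} [Group G] (x y : G) :
    Abelianization.addOf (x * y) = Abelianization.addOf x + Abelianization.addOf y := by
  simp [Abelianization.addOf]

theorem Abelianization.addOf_one {G : Type*} [Group G] :
    Abelianization.addOf (1 : G) = 0 := by
  simp [Abelianization.addOf]

theorem Abelianization.addOf_inv {G : Type*} [Group G] (x : G) :
    Abelianization.addOf x⁻¹ = - Abelianization.addOf x := by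
  simp [Abelianization.addOf]

theorem Abelianization.addOf_eq_zero_iff {G : Type*} [Group G] (x : G) :
    Abelianization.addOf x = 0 ↔ x ∈ commutator G := by
  rw [Abelianization.addOf, ofMul_eq_zero, ← MonoidHom.mem_ker, Abelianization.ker_of]

theorem Subgroup.coe_mem_commutator_of_addOf_eq_zero {F : Type*} [Group F] {H : Subgroup F} {x : H}
    (h : Abelianization.addOf x = 0) : (x : F) ∈ ⁅H, H⁆ := by
  rw [Abelianization.addOf_eq_zero_iff] at h
  rw [← Subgroup.map_subtype_commutator]
  exact ⟨x, h, rfl⟩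

theorem Subgroup.addOf_eq_zero_of_coe_mem_commutator {F : Type*} [Group F] {H : Subgroup F} {x : H}
    (h : (x : F) ∈ ⁅H, H⁆) : Abelianization.addOf x = 0 := by
  rw [Abelianization.addOf_eq_zero_iff]
  rw [← Subgroup.map_subtype_commutator] at h
  obtain ⟨y, hy, hyx⟩ := h
  rwa [← Subtype.ext hyx]

variable {F : Type*} [Group F]

theorem Subgroup.exists_extension_addOf (H : Subgroup F) :
    ∃ d : F → Additive (Abelianization H), ∀ (x : H) (g : F),
      d (x * g) = Abelianization.addOf x + d g := by
  -- Left cosets of `g⁻¹` correspond to right cosets of `g`, so this is the `H`-component of `g` for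
  -- a right transversal.
  have hmem : ∀ g : F, g * Quotient.out ((g⁻¹ : F) : F ⧸ H) ∈ H := by
    intro g
    obtain ⟨h, hh⟩ := QuotientGroup.mk_out_eq_mul H g⁻¹
    rw [hh, mul_inv_cancel_left]
    exact h.2
  refine ⟨fun g => Abelianization.addOf ⟨_, hmem g⟩, fun x g => ?_⟩
  rw [← Abelianization.addOf_mul]
  refine congrArg Abelianization.addOf (Subtype.ext ?_)
  have : (((x * g)⁻¹ : F) : F ⧸ H) = ((g⁻¹ : F) : F ⧸ H) := by
    rw [QuotientGroup.eq]; simp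
  rw [Subgroup.coe_mul]
  simp only [this, mul_assoc]

theorem MonoidAlgebra.intLift_of_sub_one_mul {A : Type*} [AddCommGroup A] (f : F → A) (x : F)
    (h : ∀ g, f (x * g) = f g) (β : MonoidAlgebra ℤ F) :
    MonoidAlgebra.intLift f ((MonoidAlgebra.of ℤ F x - 1) * β) = 0 := by
  refine MonoidAlgebra.int_addHom_ext (f := (MonoidAlgebra.intLift f).comp
    (AddMonoidHom.mulLeft (MonoidAlgebra.of ℤ F x - 1))) (g := 0) (fun g => ?_) β
  rw [AddMonoidHom.comp_apply, AddMonoidHom.coe_mulLeft, sub_mul, one_mul, ← map_mul, map_sub,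
    MonoidAlgebra.intLift_of, MonoidAlgebra.intLift_of, h, sub_self]
  rfl

/-- On the right ideal generated by the `x - 1`, `x ∈ H`, there is an additive map to the
abelianization of `H` sending `(x - 1) γ` to the class of `x` times the augmentation of `γ`. -/
theorem MonoidAlgebra.exists_addHom_sub_one_mul (H : Subgroup F) :
    ∃ d : MonoidAlgebra ℤ F →+ Additive (Abelianization H), ∀ (x : H) γ,
      d ((MonoidAlgebra.of ℤ F x - 1) * γ) =
        MonoidAlgebra.intAug F γ • Abelianization.addOf x := by
  obtain ⟨d, hd⟩ := H.exists_extension_addOf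
  refine ⟨MonoidAlgebra.intLift d, fun x γ => ?_⟩
  refine MonoidAlgebra.int_addHom_ext
    (f := (MonoidAlgebra.intLift d).comp (AddMonoidHom.mulLeft (MonoidAlgebra.of ℤ F x - 1)))
    (g := ((zmultiplesHom _ (Abelianization.addOf x)).comp
      (MonoidAlgebra.intAug F).toRingHom.toAddMonoidHom)) (fun g => ?_) γ
  rw [AddMonoidHom.comp_apply, AddMonoidHom.comp_apply, zmultiplesHom_apply]
  change _ = MonoidAlgebra.intAug F _ • _
  rw [AddMonoidHom.coe_mulLeft, sub_mul, one_mul, ← map_mul, map_sub, MonoidAlgebra.intLift_of,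
    MonoidAlgebra.intLift_of, hd, MonoidAlgebra.intAug_of, one_smul, add_sub_cancel_right]

/-- A crossed homomorphism `δ` on a subgroup `S` yields an additive map sending `α (y - 1)` to
`α • δ y` for all `α` in the group ring of the whole group and `y ∈ S`. -/
theorem MonoidAlgebra.exists_addHom_mul_sub_one (S : Subgroup F) {M : Type*} [AddCommGroup M]
    [Module (MonoidAlgebra ℤ F) M] (δ : S → M)
    (hδ : ∀ a b, δ (a * b) = δ a + MonoidAlgebra.of ℤ F a • δ b) :
    ∃ Δ : MonoidAlgebra ℤ F →+ M, ∀ α (y : S),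
      Δ (α * (MonoidAlgebra.of ℤ F y - 1)) = α • δ y := by
  have hmem : ∀ g : F, (Quotient.out (g : F ⧸ S))⁻¹ * g ∈ S := by
    intro g
    obtain ⟨h, hh⟩ := QuotientGroup.mk_out_eq_mul S g
    rw [hh]
    simp
  -- Writing `g = r s` with `r` the representative of `g S`, put `e g = r • δ s`.
  let e : F → M := fun g => MonoidAlgebra.of ℤ F (Quotient.out (g : F ⧸ S)) • δ ⟨_, hmem g⟩
  have he : ∀ g (y : S), e (g * y) = e g + MonoidAlgebra.of ℤ F g • δ y := by
    intro g y
    have hq : ((g * y : F) : F ⧸ S) = g := by rw [QuotientGroup.mk_mul_of_mem g y.2]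
    have h1 : (⟨_, hmem (g * y)⟩ : S) = ⟨_, hmem g⟩ * y := by
      refine Subtype.ext ?_
      rw [Subgroup.coe_mul]
      simp only [hq, mul_assoc]
    change _ • δ ⟨_, hmem (g * y)⟩ = _
    rw [h1, hδ, hq, smul_add, smul_smul, ← map_mul, mul_inv_cancel_left]
  refine ⟨MonoidAlgebra.intLift e, fun α y => ?_⟩
  refine MonoidAlgebra.int_addHom_ext
    (f := (MonoidAlgebra.intLift e).comp (AddMonoidHom.mulRight (MonoidAlgebra.of ℤ F y - 1)))
    (g := (smulAddHom (MonoidAlgebra ℤ F) M).flip (δ y)) (fun g => ?_) α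
  change MonoidAlgebra.intLift e _ = MonoidAlgebra.of ℤ F g • δ y
  rw [AddMonoidHom.mulRight_apply, mul_sub, mul_one, ← map_mul, map_sub, MonoidAlgebra.intLift_of,
    MonoidAlgebra.intLift_of, he, add_sub_cancel_left]

end CosetExtension

/-! ### Fox calculus: detecting `𝔯𝔰` and `𝔯𝔣𝔰`. -/

section Fox

open TensorProduct

variable {F : Type*} [Group F]

/-- For a free group `S ≤ F` the products `(a - 1) (b - 1)`, `a ∈ R`, `b ∈ S`, are detected by
`R_ab ⊗ S_ab`, and this is trivial on the ideal product `𝔯 𝔣 𝔰`. -/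
theorem exists_addHom_tensor_abelianization (R S : Subgroup F) [R.Normal] [S.Normal]
    [IsFreeGroup S] :
    ∃ Λ : MonoidAlgebra ℤ F →+
        Additive (Abelianization R) ⊗[ℤ] Additive (Abelianization S),
      (∀ (a : R) (b : S), Λ ((MonoidAlgebra.of ℤ F a - 1) * (MonoidAlgebra.of ℤ F b - 1)) =
        Abelianization.addOf a ⊗ₜ Abelianization.addOf b) ∧
      ∀ α ∈ groupRingIdeal R * groupRingIdeal (⊤ : Subgroup F) * groupRingIdeal S, Λ α = 0 := by
  let X := IsFreeGroup.Generators S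
  -- The coordinates of `δ` are the Fox derivatives with respect to a basis of `S`.
  obtain ⟨δ, hδ, hδX⟩ := IsFreeGroup.exists_crossedHom ((MonoidAlgebra.of ℤ F).comp S.subtype)
    (fun j : X => (Finsupp.single j 1 : X →₀ MonoidAlgebra ℤ F))
  obtain ⟨Δ, hΔ⟩ := MonoidAlgebra.exists_addHom_mul_sub_one S δ hδ
  obtain ⟨d, hd⟩ := MonoidAlgebra.exists_addHom_sub_one_mul R
  let Θ : (X →₀ MonoidAlgebra ℤ F) →+
      Additive (Abelianization R) ⊗[ℤ] Additive (Abelianization S) :=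
    Finsupp.liftAddHom fun j => (((TensorProduct.mk ℤ (Additive (Abelianization R))
      (Additive (Abelianization S))).flip
        (Abelianization.addOf (IsFreeGroup.of j))).toAddMonoidHom).comp d
  let κ : (X →₀ MonoidAlgebra ℤ F) →+ Additive (Abelianization S) :=
    Finsupp.liftAddHom fun j => (zmultiplesHom _ (Abelianization.addOf (IsFreeGroup.of j))).comp
      (MonoidAlgebra.intAug F).toRingHom.toAddMonoidHom
  have hΘs : ∀ j α, Θ (Finsupp.single j α) =
      d α ⊗ₜ Abelianization.addOf (IsFreeGroup.of j) := by
    intro j α; simp [Θ]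
  have hκs : ∀ j α, κ (Finsupp.single j α) =
      MonoidAlgebra.intAug F α • Abelianization.addOf (IsFreeGroup.of j) := by
    intro j α; simp [κ]
  clear_value Θ κ
  have hκsmul : ∀ α m, κ (α • m) = MonoidAlgebra.intAug F α • κ m := by
    intro α m
    induction m using Finsupp.induction_linear with
    | zero => simp
    | add f g hf hg => rw [smul_add, map_add, map_add, hf, hg, smul_add]
    | single j β => rw [Finsupp.smul_single, hκs, hκs, smul_eq_mul, map_mul, mul_smul]
  have hΘ : ∀ (a : R) γ m, Θ (((MonoidAlgebra.of ℤ F a - 1) * γ) • m) =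
      Abelianization.addOf a ⊗ₜ (MonoidAlgebra.intAug F γ • κ m) := by
    intro a γ m
    induction m using Finsupp.induction_linear with
    | zero => simp
    | add f g hf hg =>
      rw [smul_add, map_add, map_add, hf, hg, smul_add, TensorProduct.tmul_add]
    | single j β =>
      rw [Finsupp.smul_single, hΘs, hκs, smul_eq_mul, mul_assoc, hd, map_mul, mul_smul,
        TensorProduct.tmul_smul, TensorProduct.tmul_smul, TensorProduct.smul_tmul',
        TensorProduct.smul_tmul']
  -- The augmented Fox derivatives of `b` are its coordinates in `S_ab`; both sides are
  -- homomorphisms agreeing on the basis.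
  have hκδ : ∀ b : S, κ (δ b) = Abelianization.addOf b := by
    let f : S →* Multiplicative (Additive (Abelianization S)) :=
      MonoidHom.mk' (fun b => Multiplicative.ofAdd (κ (δ b))) fun a b => by
        rw [hδ, map_add, hκsmul, MonoidHom.comp_apply, MonoidAlgebra.intAug_of, one_smul, ofAdd_add]
    let f' : S →* Multiplicative (Additive (Abelianization S)) :=
      MonoidHom.mk' (fun b => Multiplicative.ofAdd (Abelianization.addOf b)) fun a b => by
        rw [Abelianization.addOf_mul, ofAdd_add]
    have hff' : f = f' := by
      apply IsFreeGroup.ext_hom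
      intro j
      change Multiplicative.ofAdd (κ (δ (IsFreeGroup.of j))) =
        Multiplicative.ofAdd (Abelianization.addOf (IsFreeGroup.of j))
      rw [hδX, hκs, map_one, one_smul]
    intro b
    exact Multiplicative.ofAdd.injective (DFunLike.congr_fun hff' b)
  refine ⟨Θ.comp Δ, fun a b => ?_, fun α hα => ?_⟩
  · have := hΘ a 1 (δ b)
    rw [mul_one, map_one, one_smul, hκδ] at this
    rw [AddMonoidHom.comp_apply, hΔ, this]
  · refine Ideal.mul_le_addSubgroup (B := (Θ.comp Δ).ker) (fun α hα γ hγ => ?_) hα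
    refine groupRingIdeal_le_of_mem_mul
      (B := (Θ.comp Δ).ker.comap (AddMonoidHom.mulLeft α)) (fun y hy γ => ?_) hγ
    rw [AddSubgroup.mem_comap, AddMonoidHom.coe_mulLeft, AddMonoidHom.mem_ker,
      AddMonoidHom.comp_apply, ← mul_assoc, hΔ _ ⟨y, hy⟩]
    refine Ideal.mul_le_addSubgroup
      (B := (Θ.comp (((smulAddHom (MonoidAlgebra ℤ F) (X →₀ MonoidAlgebra ℤ F)).flip
        (δ ⟨y, hy⟩)).comp (AddMonoidHom.mulRight γ))).ker) (fun α hα β hβ => ?_) hα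
    change Θ ((α * β * γ) • δ ⟨y, hy⟩) = 0
    rw [mul_assoc]
    refine groupRingIdeal_le_of_mul_mem
      (B := (Θ.comp (((smulAddHom (MonoidAlgebra ℤ F) (X →₀ MonoidAlgebra ℤ F)).flip
        (δ ⟨y, hy⟩)).comp (AddMonoidHom.mulRight (β * γ)))).ker) (fun x hx η => ?_) hα
    change Θ (((MonoidAlgebra.of ℤ F x - 1) * η * (β * γ)) • δ ⟨y, hy⟩) = 0
    rw [mul_assoc, hΘ ⟨x, hx⟩, map_mul, map_mul, intAug_eq_zero_of_mem_groupRingIdeal hβ]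
    simp

/-- If `w ∈ R ∩ S` and `w - 1 ∈ 𝔯 𝔰`, with `S` free, then `w` is in the derived subgroup of
`R ∩ S`. -/
theorem mem_commutator_inf_of_sub_one_mem_mul (R S : Subgroup F) [R.Normal] [S.Normal]
    [IsFreeGroup S] {w : F} (hw : w ∈ R ⊓ S)
    (h : MonoidAlgebra.of ℤ F w - 1 ∈ groupRingIdeal R * groupRingIdeal S) :
    w ∈ ⁅R ⊓ S, R ⊓ S⁆ := by
  classical
  let X := IsFreeGroup.Generators S
  obtain ⟨δ, hδ, hδX⟩ := IsFreeGroup.exists_crossedHom ((MonoidAlgebra.of ℤ F).comp S.subtype)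
    (fun j : X => (Finsupp.single j 1 : X →₀ MonoidAlgebra ℤ F))
  obtain ⟨Δ, hΔ⟩ := MonoidAlgebra.exists_addHom_mul_sub_one S δ hδ
  obtain ⟨d, hd⟩ := (R ⊓ S).exists_extension_addOf
  -- If `g ∈ R s` with `s ∈ S`, the value is `d (s x_j) - d s`. It does not depend on `s`, since two
  -- choices differ by a left factor in `R ∩ S`, and it is invariant under left multiplication by
  -- `R`.
  let e : X → F → Additive (Abelianization ↥(R ⊓ S)) := fun j g =>
    if h : ∃ s : S, g * (s : F)⁻¹ ∈ R then
      d (h.choose * (IsFreeGroup.of j : S)) - d h.choose else 0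
  have hd' : ∀ s s' y : F, s ∈ S → s' ∈ S → s * s'⁻¹ ∈ R →
      d (s * y) - d s = d (s' * y) - d s' := by
    intro s s' y hs hs' hR
    have h1 := hd ⟨s * s'⁻¹, hR, S.mul_mem hs (S.inv_mem hs')⟩ (s' * y)
    have h2 := hd ⟨s * s'⁻¹, hR, S.mul_mem hs (S.inv_mem hs')⟩ s'
    simp only [mul_assoc, inv_mul_cancel_left, inv_mul_cancel, mul_one]
      at h1 h2
    rw [h1, h2]
    abel
  have he : ∀ j (s : S) g, g * (s : F)⁻¹ ∈ R → e j g =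
      d (s * (IsFreeGroup.of j : S)) - d s := by
    intro j s g hg
    have hex : ∃ s : S, g * (s : F)⁻¹ ∈ R := ⟨s, hg⟩
    simp only [e, hex, dif_pos]
    refine hd' _ _ _ hex.choose.2 s.2 ?_
    have := R.mul_mem (R.inv_mem hex.choose_spec) hg
    simpa [mul_assoc] using this
  have heR : ∀ j x g, x ∈ R → e j (x * g) = e j g := by
    intro j x g hx
    by_cases hg : ∃ s : S, g * (s : F)⁻¹ ∈ R
    · obtain ⟨s, hs⟩ := hg
      rw [he j s g hs, he j s (x * g) (by rw [mul_assoc]; exact R.mul_mem hx hs)]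
    · have hg' : ¬ ∃ s : S, x * g * (s : F)⁻¹ ∈ R := by
        rintro ⟨s, hs⟩
        rw [mul_assoc, R.mul_mem_cancel_left hx] at hs
        exact hg ⟨s, hs⟩
      simp only [e, hg, hg', dif_neg, not_false_eq_true]
  clear_value e
  let E : (X →₀ MonoidAlgebra ℤ F) →+ Additive (Abelianization ↥(R ⊓ S)) :=
    Finsupp.liftAddHom fun j => MonoidAlgebra.intLift (e j)
  have hEs : ∀ j α, E (Finsupp.single j α) = MonoidAlgebra.intLift (e j) α := by
    intro j α; simp [E]
  clear_value E
  have hE : ∀ x ∈ R, ∀ m, E ((MonoidAlgebra.of ℤ F x - 1) • m) = 0 := by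
    intro x hx m
    induction m using Finsupp.induction_linear with
    | zero => simp
    | add f g hf hg => rw [smul_add, map_add, hf, hg, add_zero]
    | single j β =>
      rw [Finsupp.smul_single, hEs, smul_eq_mul]
      exact MonoidAlgebra.intLift_of_sub_one_mul _ _ (fun g => heR j x g hx) β
  have hδ1 : δ 1 = 0 := by
    have := hδ 1 1
    rw [mul_one, map_one, one_smul] at this
    exact left_eq_add.1 this
  -- The functional integrates Fox derivatives to differences of `d`. At `s = 1`, `b = w` it returns
  -- the class of `w` in the abelianization of `R ∩ S`.
  have hEδ : ∀ b s : S, E (MonoidAlgebra.of ℤ F s • δ b) = d (s * b) - d s := by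
    intro b
    have hb : b ∈ Subgroup.closure (Set.range (IsFreeGroup.of : X → S)) := by
      rw [IsFreeGroup.closure_range_of_eq_top]; trivial
    induction hb using Subgroup.closure_induction with
    | mem x hx =>
      obtain ⟨j, rfl⟩ := hx
      intro s
      rw [hδX, Finsupp.smul_single, hEs, smul_eq_mul, mul_one, MonoidAlgebra.intLift_of,
        he j s s (by simp)]
    | one =>
      intro s
      simp [hδ1]
    | mul x y _ _ hx hy =>
      intro s
      rw [hδ, smul_add, map_add, hx, smul_smul, MonoidHom.comp_apply, ← map_mul]
      have := hy (s * x)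
      rw [Subgroup.coe_mul] at this
      rw [Subgroup.coe_subtype, this, Subgroup.coe_mul, mul_assoc]
      abel
    | inv x _ hx =>
      intro s
      have h1 : δ x⁻¹ = - (MonoidAlgebra.of ℤ F (x⁻¹ : S) • δ x) := by
        have h2 := hδ x⁻¹ x
        rw [inv_mul_cancel, hδ1] at h2
        exact eq_neg_of_add_eq_zero_left h2.symm
      have h2 := hx (s * x⁻¹)
      rw [Subgroup.coe_mul] at h2
      rw [h1, smul_neg, map_neg, smul_smul, ← map_mul, h2, Subgroup.coe_inv, inv_mul_cancel_right]
      abel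
  have hEΔ : E (Δ (MonoidAlgebra.of ℤ F w - 1)) = 0 := by
    refine Ideal.mul_le_addSubgroup (B := (E.comp Δ).ker) (fun α hα γ hγ => ?_) h
    refine groupRingIdeal_le_of_mem_mul
      (B := (E.comp Δ).ker.comap (AddMonoidHom.mulLeft α)) (fun y hy γ => ?_) hγ
    rw [AddSubgroup.mem_comap, AddMonoidHom.coe_mulLeft, AddMonoidHom.mem_ker,
      AddMonoidHom.comp_apply, ← mul_assoc, hΔ _ ⟨y, hy⟩]
    refine groupRingIdeal_le_of_mul_mem
      (B := (E.comp (((smulAddHom (MonoidAlgebra ℤ F) (X →₀ MonoidAlgebra ℤ F)).flip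
        (δ ⟨y, hy⟩)).comp (AddMonoidHom.mulRight γ))).ker)
      (fun x hx η => ?_) hα
    change E (((MonoidAlgebra.of ℤ F x - 1) * η * γ) • δ ⟨y, hy⟩) = 0
    rw [mul_assoc, mul_smul, hE x hx]
  have h1 := hΔ 1 ⟨w, hw.2⟩
  rw [one_mul, one_smul] at h1
  rw [h1] at hEΔ
  have h2 := hEδ ⟨w, hw.2⟩ 1
  rw [Subgroup.coe_one, map_one, one_smul, hEΔ] at h2
  have h3 := hd ⟨w, hw⟩ 1
  simp only [mul_one, one_mul] at h2 h3
  rw [h3, add_sub_cancel_right] at h2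
  exact Subgroup.coe_mem_commutator_of_addOf_eq_zero (x := ⟨w, hw⟩) h2.symm

end Fox

/-! ### Commutators of elements in the convention `g⁻¹ h⁻¹ g h`. -/

section ElementCommutators

open scoped commutatorElement

variable {G : Type*} [Group G]

theorem commutatorElement_eq_elemComm (g h : G) : ⁅g, h⁆ = elemComm g⁻¹ h⁻¹ := by
  simp [elemComm, commutatorElement_def]

theorem elemComm_eq_commutatorElement (g h : G) : elemComm g h = ⁅g⁻¹, h⁻¹⁆ := by
  simp [elemComm, commutatorElement_def]

theorem elemComm_mem_commutator {A B : Subgroup G} {a b : G} (ha : a ∈ A) (hb : b ∈ B) :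
    elemComm a b ∈ ⁅A, B⁆ := by
  rw [elemComm_eq_commutatorElement]
  exact Subgroup.commutator_mem_commutator (A.inv_mem ha) (B.inv_mem hb)

theorem map_elemComm {H : Type*} [Group H] (f : G →* H) (a b : G) :
    f (elemComm a b) = elemComm (f a) (f b) := by
  simp [elemComm]

theorem elemComm_mul_left_of_mem_center {a c : G} (h : elemComm a c ∈ Subgroup.center G) (b : G) :
    elemComm (a * b) c = elemComm a c * elemComm b c := by
  have h1 := Subgroup.mem_center_iff.1 h b⁻¹
  calc elemComm (a * b) c = b⁻¹ * elemComm a c * (c⁻¹ * b * c) := by simp [elemComm, mul_assoc]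
    _ = elemComm a c * elemComm b c := by rw [h1]; simp [elemComm, mul_assoc]

theorem elemComm_mul_right_of_mem_center {a b : G} (h : elemComm a b ∈ Subgroup.center G) (c : G) :
    elemComm a (b * c) = elemComm a b * elemComm a c := by
  have h1 := Subgroup.mem_center_iff.1 h (a⁻¹ * c⁻¹ * a)
  calc elemComm a (b * c) = (a⁻¹ * c⁻¹ * a * elemComm a b) * c := by simp [elemComm, mul_assoc]
    _ = elemComm a b * elemComm a c := by rw [h1]; simp [elemComm, mul_assoc]

end ElementCommutators

/-! ### Biadditive maps on groups. -/

section BilinearLift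

open TensorProduct

theorem Abelianization.exists_addOf_eq {G : Type*} [Group G] (p : Additive (Abelianization G)) :
    ∃ g, Abelianization.addOf g = p :=
  QuotientGroup.mk_surjective p

/-- A biadditive map on a pair of groups factors through the abelianizations. -/
theorem Abelianization.exists_bilin {G H Q : Type*} [Group G] [Group H] [AddCommGroup Q]
    (f : G → H → Q) (hl : ∀ a a' b, f (a * a') b = f a b + f a' b)
    (hr : ∀ a b b', f a (b * b') = f a b + f a b') :
    ∃ β : Additive (Abelianization G) →ₗ[ℤ] Additive (Abelianization H) →ₗ[ℤ] Q,
      ∀ a b, β (Abelianization.addOf a) (Abelianization.addOf b) = f a b := by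
  let φ : G → H →* Multiplicative Q := fun a =>
    MonoidHom.mk' (fun b => Multiplicative.ofAdd (f a b)) fun b b' => by rw [hr, ofAdd_add]
  let r : G → (Additive (Abelianization H) →ₗ[ℤ] Q) := fun a =>
    (MonoidHom.toAdditiveLeft (Abelianization.lift (φ a))).toIntLinearMap
  have hr' : ∀ a b, r a (Abelianization.addOf b) = f a b := fun a b =>
    congrArg Multiplicative.toAdd (Abelianization.lift_apply_of (φ a) b)
  let ψ : G →* Multiplicative (Additive (Abelianization H) →ₗ[ℤ] Q) :=
    MonoidHom.mk' (fun a => Multiplicative.ofAdd (r a)) fun a a' => by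
      rw [← ofAdd_add]
      congr 1
      refine LinearMap.ext fun b => ?_
      obtain ⟨b, rfl⟩ := Abelianization.exists_addOf_eq b
      rw [LinearMap.add_apply, hr', hr', hr', hl]
  refine ⟨(MonoidHom.toAdditiveLeft (Abelianization.lift ψ)).toIntLinearMap, fun a b => ?_⟩
  rw [← hr']
  exact congrArg (fun q : Multiplicative (Additive (Abelianization H) →ₗ[ℤ] Q) =>
    Multiplicative.toAdd q (Abelianization.addOf b))
    (Abelianization.lift_apply_of ψ a)

end BilinearLift

/-! ### The inclusion of the four factors in `1 + 𝔯𝔣𝔰`. -/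

section CapOneAdd

open scoped commutatorElement

variable {F : Type*} [Group F]

/-- The subgroup of all `g` with `g - 1 ∈ I`. -/
def capOneAddSubgroup (I : Ideal (MonoidAlgebra ℤ F)) [I.IsTwoSided] : Subgroup F where
  carrier := groupCapOneAdd I
  one_mem' := by simp [groupCapOneAdd, MonoidAlgebra.one_def]
  mul_mem' {a b} ha hb := by
    have : MonoidAlgebra.of ℤ F (a * b) - 1 =
        MonoidAlgebra.of ℤ F a * (MonoidAlgebra.of ℤ F b - 1) + (MonoidAlgebra.of ℤ F a - 1) := by
      rw [map_mul]; noncomm_ring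
    change _ - 1 ∈ I
    rw [this]
    exact I.add_mem (I.mul_mem_left _ hb) ha
  inv_mem' {a} ha := by
    have : MonoidAlgebra.of ℤ F a⁻¹ - 1 =
        - (MonoidAlgebra.of ℤ F a⁻¹ * (MonoidAlgebra.of ℤ F a - 1)) := by
      rw [mul_sub, ← map_mul, inv_mul_cancel, map_one]; noncomm_ring
    change _ - 1 ∈ I
    rw [this]
    exact I.neg_mem (I.mul_mem_left _ ha)

theorem mem_capOneAddSubgroup {I : Ideal (MonoidAlgebra ℤ F)} [I.IsTwoSided] {g : F} :
    g ∈ capOneAddSubgroup I ↔ MonoidAlgebra.of ℤ F g - 1 ∈ I := Iff.rfl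

theorem of_elemComm_sub_one (a b : F) :
    MonoidAlgebra.of ℤ F (elemComm a b) - 1 = MonoidAlgebra.of ℤ F (a⁻¹ * b⁻¹) *
      ((MonoidAlgebra.of ℤ F a - 1) * (MonoidAlgebra.of ℤ F b - 1) -
        (MonoidAlgebra.of ℤ F b - 1) * (MonoidAlgebra.of ℤ F a - 1)) := by
  have h1 : (MonoidAlgebra.of ℤ F a - 1) * (MonoidAlgebra.of ℤ F b - 1) -
        (MonoidAlgebra.of ℤ F b - 1) * (MonoidAlgebra.of ℤ F a - 1) =
      MonoidAlgebra.of ℤ F (a * b) - MonoidAlgebra.of ℤ F (b * a) := by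
    rw [map_mul, map_mul]; noncomm_ring
  rw [h1, mul_sub, ← map_mul, ← map_mul, elemComm]
  have h2 : a⁻¹ * b⁻¹ * (b * a) = 1 := by group
  rw [h2, map_one, mul_assoc _ a b]

theorem elemComm_mem_capOneAddSubgroup {I : Ideal (MonoidAlgebra ℤ F)} [I.IsTwoSided] {a b : F}
    (h₁ : (MonoidAlgebra.of ℤ F a - 1) * (MonoidAlgebra.of ℤ F b - 1) ∈ I)
    (h₂ : (MonoidAlgebra.of ℤ F b - 1) * (MonoidAlgebra.of ℤ F a - 1) ∈ I) :
    elemComm a b ∈ capOneAddSubgroup I := by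
  rw [mem_capOneAddSubgroup, of_elemComm_sub_one]
  exact I.mul_mem_left _ (I.sub_mem h₁ h₂)

theorem commutator_le_capOneAddSubgroup {I : Ideal (MonoidAlgebra ℤ F)} [I.IsTwoSided]
    {A B : Subgroup F}
    (h₁ : ∀ a ∈ A, ∀ b ∈ B, (MonoidAlgebra.of ℤ F a - 1) * (MonoidAlgebra.of ℤ F b - 1) ∈ I)
    (h₂ : ∀ a ∈ A, ∀ b ∈ B, (MonoidAlgebra.of ℤ F b - 1) * (MonoidAlgebra.of ℤ F a - 1) ∈ I) :
    ⁅A, B⁆ ≤ capOneAddSubgroup I := by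
  rw [Subgroup.commutator_le]
  intro a ha b hb
  rw [commutatorElement_eq_elemComm]
  exact elemComm_mem_capOneAddSubgroup (h₁ _ (A.inv_mem ha) _ (B.inv_mem hb))
    (h₂ _ (A.inv_mem ha) _ (B.inv_mem hb))

theorem groupRingIdeal_mono {G H : Subgroup F} (h : G ≤ H) :
    groupRingIdeal G ≤ groupRingIdeal H :=
  TwoSidedIdeal.asIdeal.monotone (TwoSidedIdeal.span_mono fun _ ⟨g, hg, hx⟩ => ⟨g, h hg, hx⟩)

theorem of_sub_one_mem_sq_of_mem_commutator {G : Subgroup F} {g : F} (hg : g ∈ ⁅G, G⁆) :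
    MonoidAlgebra.of ℤ F g - 1 ∈ groupRingIdeal G * groupRingIdeal G :=
  commutator_le_capOneAddSubgroup (I := groupRingIdeal G * groupRingIdeal G)
    (fun _ ha _ hb => Ideal.mul_mem_mul (of_sub_one_mem_groupRingIdeal ha)
      (of_sub_one_mem_groupRingIdeal hb))
    (fun _ ha _ hb => Ideal.mul_mem_mul (of_sub_one_mem_groupRingIdeal hb)
      (of_sub_one_mem_groupRingIdeal ha)) hg

section Triple

variable {R S : Subgroup F}

/-- The product ideal `𝔯 𝔣 𝔰`. -/
noncomputable abbrev tripleIdeal (R S : Subgroup F) : Ideal (MonoidAlgebra ℤ F) :=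
  groupRingIdeal R * groupRingIdeal (⊤ : Subgroup F) * groupRingIdeal S

theorem mul_mul_mem_triple {α β γ : MonoidAlgebra ℤ F} (hα : α ∈ groupRingIdeal R)
    (hβ : β ∈ groupRingIdeal (⊤ : Subgroup F)) (hγ : γ ∈ groupRingIdeal S) :
    α * β * γ ∈ tripleIdeal R S :=
  Ideal.mul_mem_mul (Ideal.mul_mem_mul hα hβ) hγ

theorem mul_mem_triple_of_mem_commutator_left {a b : F} (ha : a ∈ ⁅R, R⁆) (hb : b ∈ S) :
    (MonoidAlgebra.of ℤ F a - 1) * (MonoidAlgebra.of ℤ F b - 1) ∈ tripleIdeal R S :=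
  Ideal.mul_mem_mul (Ideal.mul_mono_right (groupRingIdeal_mono le_top)
    (of_sub_one_mem_sq_of_mem_commutator ha)) (of_sub_one_mem_groupRingIdeal hb)

theorem mul_mem_triple_of_mem_commutator_right {a b : F} (ha : a ∈ R) (hb : b ∈ ⁅S, S⁆) :
    (MonoidAlgebra.of ℤ F a - 1) * (MonoidAlgebra.of ℤ F b - 1) ∈ tripleIdeal R S := by
  rw [tripleIdeal, mul_assoc]
  exact Ideal.mul_mem_mul (of_sub_one_mem_groupRingIdeal ha)
    (Ideal.mul_mono_left (groupRingIdeal_mono le_top) (of_sub_one_mem_sq_of_mem_commutator hb))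

/-- The factor `a⁻¹ b⁻¹` in `of_elemComm_sub_one` may be replaced by `1`: the error has `a⁻¹ b⁻¹ - 1
∈ 𝔯`, then one factor in `𝔣` and one in `𝔰`. -/
theorem of_elemComm_sub_one_sub_mem_triple {a b : F} (ha : a ∈ R ⊓ S) (hb : b ∈ R ⊓ S) :
    MonoidAlgebra.of ℤ F (elemComm a b) - 1 -
      ((MonoidAlgebra.of ℤ F a - 1) * (MonoidAlgebra.of ℤ F b - 1) -
        (MonoidAlgebra.of ℤ F b - 1) * (MonoidAlgebra.of ℤ F a - 1)) ∈ tripleIdeal R S := by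
  have hab : MonoidAlgebra.of ℤ F (a⁻¹ * b⁻¹) - 1 ∈ groupRingIdeal R :=
    of_sub_one_mem_groupRingIdeal (R.mul_mem (R.inv_mem ha.1) (R.inv_mem hb.1))
  have h1 := (tripleIdeal R S).sub_mem
    (mul_mul_mem_triple hab (of_sub_one_mem_groupRingIdeal (Subgroup.mem_top a))
      (of_sub_one_mem_groupRingIdeal hb.2))
    (mul_mul_mem_triple hab (of_sub_one_mem_groupRingIdeal (Subgroup.mem_top b))
      (of_sub_one_mem_groupRingIdeal ha.2))
  convert h1 using 1
  rw [of_elemComm_sub_one]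
  noncomm_ring

open TensorProduct in
/-- The map from `R_ab ⊗ S_ab` to the group ring modulo `𝔯 𝔣 𝔰` given by `(a - 1) (b - 1)`. -/
theorem exists_tensor_addHom_quotient (R S : Subgroup F) :
    ∃ Ψ : Additive (Abelianization R) ⊗[ℤ] Additive (Abelianization S) →ₗ[ℤ]
        MonoidAlgebra ℤ F ⧸ (tripleIdeal R S).toAddSubgroup, ∀ (a : R) (b : S),
      Ψ (Abelianization.addOf a ⊗ₜ Abelianization.addOf b) =
        ((MonoidAlgebra.of ℤ F a - 1) * (MonoidAlgebra.of ℤ F b - 1) : MonoidAlgebra ℤ F) := by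
  let f : R → S → MonoidAlgebra ℤ F ⧸ (tripleIdeal R S).toAddSubgroup := fun a b =>
    ((MonoidAlgebra.of ℤ F a - 1) * (MonoidAlgebra.of ℤ F b - 1) : MonoidAlgebra ℤ F)
  have hl : ∀ a a' b, f (a * a') b = f a b + f a' b := by
    intro a a' b
    rw [← QuotientAddGroup.mk_add, eq_comm, QuotientAddGroup.eq]
    have := mul_mul_mem_triple (of_sub_one_mem_groupRingIdeal a.2)
      (of_sub_one_mem_groupRingIdeal (Subgroup.mem_top (a' : F)))
      (of_sub_one_mem_groupRingIdeal b.2)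
    change _ ∈ tripleIdeal R S
    convert this using 1
    rw [Subgroup.coe_mul, map_mul]
    noncomm_ring
  have hr : ∀ a b b', f a (b * b') = f a b + f a b' := by
    intro a b b'
    rw [← QuotientAddGroup.mk_add, eq_comm, QuotientAddGroup.eq]
    have := mul_mul_mem_triple (of_sub_one_mem_groupRingIdeal a.2)
      (of_sub_one_mem_groupRingIdeal (Subgroup.mem_top (b : F)))
      (of_sub_one_mem_groupRingIdeal b'.2)
    change _ ∈ tripleIdeal R S
    convert this using 1
    rw [Subgroup.coe_mul, map_mul]
    noncomm_ring
  obtain ⟨β, hβ⟩ := Abelianization.exists_bilin f hl hr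
  exact ⟨TensorProduct.lift β, fun a b => hβ a b⟩

open TensorProduct in
-- The terms `(x₁ - 1)(y - 1)` and `(x - 1)(y₂ - 1)` lie in `𝔯𝔣𝔰` already. The opposite products
-- agree modulo it because `x₁ = m x` in `S_ab`, `y₂ = m y` in `R_ab`, and `m` passes across the
-- tensor sign.
theorem subgroupW_le_capOneAddSubgroup [R.Normal] [S.Normal] [IsFreeGroup R] [IsFreeGroup S] :
    subgroupW R S ≤ capOneAddSubgroup (tripleIdeal R S) := by
  rw [subgroupW, Subgroup.closure_le]
  rintro w ⟨x, y, x₁, x₂, y₁, y₂, m, hx, hy, hm, hxm, hym, hx₁, hy₁, hx₂, hy₂, rfl⟩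
  have hRle : ⁅R, R⁆ ≤ R := Subgroup.commutator_le_left R R
  have hSle : ⁅S, S⁆ ≤ S := Subgroup.commutator_le_left S S
  have key : (MonoidAlgebra.of ℤ F y - 1) * (MonoidAlgebra.of ℤ F x₁ - 1) -
      (MonoidAlgebra.of ℤ F y₂ - 1) * (MonoidAlgebra.of ℤ F x - 1) ∈ tripleIdeal R S := by
    obtain ⟨Ψ, hΨ⟩ := exists_tensor_addHom_quotient R S
    have := IsFreeGroup.isTorsionFree_abelianization R
    have := IsFreeGroup.isTorsionFree_abelianization S
    have hy' : m • Abelianization.addOf (⟨y, hy.1⟩ : R) =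
        Abelianization.addOf (⟨y₂, hy₂.1⟩ : R) := by
      have h1 : (⟨y, hy.1⟩ : R) ^ m = ⟨y₁, hRle hy₁.1⟩ * ⟨y₂, hy₂.1⟩ := Subtype.ext hym
      have h2 := congrArg Abelianization.addOf h1
      have h3 : Abelianization.addOf (⟨y₁, hRle hy₁.1⟩ : R) = 0 :=
        Subgroup.addOf_eq_zero_of_coe_mem_commutator hy₁.1
      rw [Abelianization.addOf_mul, h3, zero_add] at h2
      exact h2
    have hx' : m • Abelianization.addOf (⟨x, hx.2⟩ : S) =
        Abelianization.addOf (⟨x₁, hx₁.2⟩ : S) := by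
      have h1 : (⟨x, hx.2⟩ : S) ^ m = ⟨x₁, hx₁.2⟩ * ⟨x₂, hSle hx₂.2⟩ := Subtype.ext hxm
      have h2 := congrArg Abelianization.addOf h1
      have h3 : Abelianization.addOf (⟨x₂, hSle hx₂.2⟩ : S) = 0 :=
        Subgroup.addOf_eq_zero_of_coe_mem_commutator hx₂.2
      rw [Abelianization.addOf_mul, h3, add_zero] at h2
      exact h2
    have h3 : Abelianization.addOf (⟨y, hy.1⟩ : R) ⊗ₜ[ℤ] Abelianization.addOf (⟨x₁, hx₁.2⟩ : S) =
        Abelianization.addOf (⟨y₂, hy₂.1⟩ : R) ⊗ₜ[ℤ] Abelianization.addOf (⟨x, hx.2⟩ : S) := by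
      rw [← hy', ← hx', ← TensorProduct.smul_tmul]
    have h4 := congrArg Ψ h3
    rw [hΨ, hΨ, QuotientAddGroup.eq] at h4
    have h5 := (tripleIdeal R S).neg_mem h4
    convert h5 using 1
    noncomm_ring
  have hx₁D : x₁ ∈ R ⊓ S := ⟨hRle hx₁.1, hx₁.2⟩
  have hy₂D : y₂ ∈ R ⊓ S := ⟨hy₂.1, hSle hy₂.2⟩
  have h1 := of_elemComm_sub_one_sub_mem_triple hx₁D hy
  have h2 := of_elemComm_sub_one_sub_mem_triple hx hy₂D
  have h3 := mul_mem_triple_of_mem_commutator_left (S := S) hx₁.1 hy.2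
  have h4 := mul_mem_triple_of_mem_commutator_right (R := R) hx.1 hy₂.2
  have h5 : MonoidAlgebra.of ℤ F (elemComm x₁ y) - MonoidAlgebra.of ℤ F (elemComm x y₂) ∈
      tripleIdeal R S := by
    have := (tripleIdeal R S).sub_mem ((tripleIdeal R S).add_mem
      ((tripleIdeal R S).sub_mem h1 h2) ((tripleIdeal R S).sub_mem h3 h4)) key
    convert this using 1
    abel
  change _ - 1 ∈ tripleIdeal R S
  have h6 := (tripleIdeal R S).mul_mem_right (MonoidAlgebra.of ℤ F (elemComm x y₂)⁻¹) h5
  convert h6 using 1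
  rw [sub_mul, ← map_mul, ← map_mul, mul_inv_cancel, map_one]

end Triple

end CapOneAdd

/-! ### The commutator as an alternating form. -/

section CentralQuotient

open scoped commutatorElement IsMulCommutative

universe u

/-- If `K` contains `[G', G]`, the commutator modulo `K` is an alternating bilinear form on the
abelianization of `G`, with values in the centre of `G ⧸ K`. -/
theorem exists_commutator_bilin {G : Type u} [Group G] (K : Subgroup G) [K.Normal]
    (hK : ⁅commutator G, (⊤ : Subgroup G)⁆ ≤ K) :
    ∃ (T : Type u) (_ : AddCommGroup T) (ι : Multiplicative T →* G ⧸ K)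
      (β : Additive (Abelianization G) →ₗ[ℤ] Additive (Abelianization G) →ₗ[ℤ] T),
      Function.Injective ι ∧ (∀ a b, ι (Multiplicative.ofAdd
        (β (Abelianization.addOf a) (Abelianization.addOf b))) = (elemComm a b : G)) ∧
      ∀ p, β p p = 0 := by
  have hcen : ∀ a b : G, elemComm (a : G ⧸ K) (b : G ⧸ K) ∈ Subgroup.center (G ⧸ K) := by
    intro a b
    rw [Subgroup.mem_center_iff]
    intro g
    obtain ⟨g, rfl⟩ := QuotientGroup.mk_surjective g
    have h1 : elemComm a b ∈ commutator G := elemComm_mem_commutator trivial trivial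
    have h2 : ⁅elemComm a b, g⁆ ∈ K := hK (Subgroup.commutator_mem_commutator h1 trivial)
    have h3 : ((⁅elemComm a b, g⁆ : G) : G ⧸ K) = 1 := (QuotientGroup.eq_one_iff _).2 h2
    rw [← QuotientGroup.coe_mk', map_commutatorElement, commutatorElement_eq_one_iff_mul_comm,
      map_elemComm] at h3
    exact h3.symm
  let f : G → G → Additive (Subgroup.center (G ⧸ K)) := fun a b =>
    Additive.ofMul ⟨elemComm (a : G ⧸ K) (b : G ⧸ K), hcen a b⟩
  obtain ⟨β, hβ⟩ := Abelianization.exists_bilin f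
    (fun a a' b => congrArg Additive.ofMul
      (Subtype.ext (elemComm_mul_left_of_mem_center (hcen a b) (a' : G ⧸ K))))
    (fun a b b' => by
      rw [add_comm]
      refine congrArg Additive.ofMul (Subtype.ext ?_)
      have h1 := elemComm_mul_right_of_mem_center (hcen a b) (b' : G ⧸ K)
      have h2 := Subgroup.mem_center_iff.1 (hcen a b) (elemComm (a : G ⧸ K) (b' : G ⧸ K))
      exact h1.trans h2.symm)
  refine ⟨_, inferInstance, MonoidHom.mk' (fun t => ((Additive.toMul (Multiplicative.toAdd t) :
    Subgroup.center (G ⧸ K)) : G ⧸ K)) (fun _ _ => rfl), β,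
    fun s t h => congrArg Multiplicative.ofAdd (Additive.toMul.injective (Subtype.ext h)),
    fun a b => ?_, fun p => ?_⟩
  · rw [hβ]
    exact (map_elemComm (QuotientGroup.mk' K) a b).symm
  · obtain ⟨a, rfl⟩ := Abelianization.exists_addOf_eq p
    rw [hβ]
    refine congrArg Additive.ofMul (Subtype.ext ?_)
    simp [elemComm]

end CentralQuotient

/-! ### The inclusion of `F ∩ (1 + 𝔯𝔣𝔰)` in the four factors. -/

section Main

open TensorProduct
open scoped commutatorElement

variable {F : Type*} [Group F]

/-- The commutator form of `R ∩ S` modulo a subgroup `K` containing the four factors satisfies the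
compatibility required of `β` in `LinearMap.lift_eq_zero_of_map_sub_comm_eq_zero`. -/
theorem commutator_bilin_compat {R S : Subgroup F} {T : Type*} [AddCommGroup T]
    (K : Subgroup F)
    (h₁ : ⁅⁅R, R⁆ ⊓ ⁅S, S⁆, R ⊓ S⁆ ≤ K) (h₂ : ⁅⁅R, R⁆ ⊓ S, ⁅R, R⁆ ⊓ S⁆ ≤ K)
    (h₃ : ⁅R ⊓ ⁅S, S⁆, R ⊓ ⁅S, S⁆⁆ ≤ K) (h₄ : subgroupW R S ≤ K)
    (ρ : Additive (Abelianization ↥(R ⊓ S)) →ₗ[ℤ] Additive (Abelianization R))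
    (hρ : ∀ a : ↥(R ⊓ S), ρ (Abelianization.addOf a) = Abelianization.addOf ⟨a, a.2.1⟩)
    (σ : Additive (Abelianization ↥(R ⊓ S)) →ₗ[ℤ] Additive (Abelianization S))
    (hσ : ∀ a : ↥(R ⊓ S), σ (Abelianization.addOf a) = Abelianization.addOf ⟨a, a.2.2⟩)
    (β : Additive (Abelianization ↥(R ⊓ S)) →ₗ[ℤ] Additive (Abelianization ↥(R ⊓ S)) →ₗ[ℤ] T)
    (hβ : ∀ a b c d : ↥(R ⊓ S), elemComm (a : F) b * (elemComm (c : F) d)⁻¹ ∈ K →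
      β (Abelianization.addOf a) (Abelianization.addOf b) =
        β (Abelianization.addOf c) (Abelianization.addOf d))
    (m : ℤ) (x y x₁ x₂ y₁ y₂ : Additive (Abelianization ↥(R ⊓ S)))
    (hx₁ : ρ x₁ = 0) (hy₁ : ρ y₁ = 0) (hx₂ : σ x₂ = 0) (hy₂ : σ y₂ = 0)
    (hx : m • x = x₁ + x₂) (hy : m • y = y₁ + y₂) : β x₁ y = β x y₂ := by
  have hβ0 : ∀ a b : ↥(R ⊓ S), elemComm (a : F) b ∈ K →
      β (Abelianization.addOf a) (Abelianization.addOf b) = 0 := by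
    intro a b h
    rw [hβ a b 1 1 (by simpa [elemComm] using h), Abelianization.addOf_one, map_zero]
  have hρ0 : ∀ a : ↥(R ⊓ S), ρ (Abelianization.addOf a) = 0 → (a : F) ∈ ⁅R, R⁆ := by
    intro a h
    rw [hρ] at h
    exact Subgroup.coe_mem_commutator_of_addOf_eq_zero h
  have hσ0 : ∀ a : ↥(R ⊓ S), σ (Abelianization.addOf a) = 0 → (a : F) ∈ ⁅S, S⁆ := by
    intro a h
    rw [hσ] at h
    exact Subgroup.coe_mem_commutator_of_addOf_eq_zero h
  have hUV : ∀ u v, ρ u = 0 → σ u = 0 → β u v = 0 := by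
    intro u v hu hu'
    obtain ⟨a, rfl⟩ := Abelianization.exists_addOf_eq u
    obtain ⟨b, rfl⟩ := Abelianization.exists_addOf_eq v
    exact hβ0 a b (h₁ (elemComm_mem_commutator ⟨hρ0 a hu, hσ0 a hu'⟩ b.2))
  have hVU : ∀ u v, ρ v = 0 → σ v = 0 → β u v = 0 := by
    intro u v hu hu'
    obtain ⟨a, rfl⟩ := Abelianization.exists_addOf_eq u
    obtain ⟨b, rfl⟩ := Abelianization.exists_addOf_eq v
    refine hβ0 a b (h₁ ?_)
    rw [Subgroup.commutator_comm]
    exact elemComm_mem_commutator a.2 ⟨hρ0 b hu, hσ0 b hu'⟩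
  have hUU : ∀ u v, ρ u = 0 → ρ v = 0 → β u v = 0 := by
    intro u v hu hv
    obtain ⟨a, rfl⟩ := Abelianization.exists_addOf_eq u
    obtain ⟨b, rfl⟩ := Abelianization.exists_addOf_eq v
    exact hβ0 a b (h₂ (elemComm_mem_commutator ⟨hρ0 a hu, a.2.2⟩ ⟨hρ0 b hv, b.2.2⟩))
  have hVV : ∀ u v, σ u = 0 → σ v = 0 → β u v = 0 := by
    intro u v hu hv
    obtain ⟨a, rfl⟩ := Abelianization.exists_addOf_eq u
    obtain ⟨b, rfl⟩ := Abelianization.exists_addOf_eq v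
    exact hβ0 a b (h₃ (elemComm_mem_commutator ⟨a.2.1, hσ0 a hu⟩ ⟨b.2.1, hσ0 b hv⟩))
  have hnat : ∀ (n : ℕ) (x₁ x₂ y₁ y₂ : Additive (Abelianization ↥(R ⊓ S))), ρ x₁ = 0 → ρ y₁ = 0 →
      σ x₂ = 0 → σ y₂ = 0 → n • x = x₁ + x₂ → n • y = y₁ + y₂ → β x₁ y = β x y₂ := by
    intro n x₁ x₂ y₁ y₂ hx₁ hy₁ hx₂ hy₂ hx hy
    -- `W` only provides exponents at least `2`. For `0`, both `x₁` and `y₂` are killed by `ρ` and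
    -- `σ`; for `1`, both sides equal `β x₁ y₂` by `hUU` and `hVV`.
    rcases n with _ | _ | n
    · rw [zero_smul] at hx hy
      have h5 : x₁ = - x₂ := eq_neg_of_add_eq_zero_left hx.symm
      have h6 : y₂ = - y₁ := eq_neg_of_add_eq_zero_right hy.symm
      rw [hUV x₁ y hx₁ (by rw [h5, map_neg, hx₂, neg_zero]),
        hVU x y₂ (by rw [h6, map_neg, hy₁, neg_zero]) hy₂]
    · rw [zero_add, one_smul] at hx hy
      rw [hx, hy, map_add, map_add, LinearMap.add_apply, hUU x₁ y₁ hx₁ hy₁, hVV x₂ y₂ hx₂ hy₂]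
      abel
    · obtain ⟨a, rfl⟩ := Abelianization.exists_addOf_eq x
      obtain ⟨b, rfl⟩ := Abelianization.exists_addOf_eq y
      obtain ⟨a₁, rfl⟩ := Abelianization.exists_addOf_eq x₁
      obtain ⟨b₁, rfl⟩ := Abelianization.exists_addOf_eq y₁
      have hpow : ∀ (c : ↥(R ⊓ S)) (k : ℕ),
          Abelianization.addOf (c ^ k) = k • Abelianization.addOf c := fun c k => rfl
      -- The lift of `x₂` is chosen so that `a ^ m = a₁ a₂` holds in the group itself, as `W`
      -- demands, and not just modulo commutators.
      have hx₂' : Abelianization.addOf (a₁⁻¹ * a ^ (n + 1 + 1)) = x₂ := by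
        rw [Abelianization.addOf_mul, Abelianization.addOf_inv, hpow, hx]; abel
      have hy₂' : Abelianization.addOf (b₁⁻¹ * b ^ (n + 1 + 1)) = y₂ := by
        rw [Abelianization.addOf_mul, Abelianization.addOf_inv, hpow, hy]; abel
      rw [← hx₂'] at hx₂
      rw [← hy₂'] at hy₂ ⊢
      refine hβ _ _ _ _ (h₄ (Subgroup.subset_closure ⟨a, b, a₁, (a₁⁻¹ * a ^ (n + 1 + 1) : ↥(R ⊓ S)),
        b₁, (b₁⁻¹ * b ^ (n + 1 + 1) : ↥(R ⊓ S)), n + 1 + 1, a.2, b.2, by omega, ?_, ?_,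
        ⟨hρ0 _ hx₁, a₁.2.2⟩, ⟨hρ0 _ hy₁, b₁.2.2⟩, ⟨Subtype.prop (_ : ↥(R ⊓ S)) |>.1, hσ0 _ hx₂⟩,
        ⟨Subtype.prop (_ : ↥(R ⊓ S)) |>.1, hσ0 _ hy₂⟩, rfl⟩))
      · simp
      · simp
  obtain ⟨n, rfl | rfl⟩ := m.eq_nat_or_neg
  · rw [natCast_zsmul] at hx hy
    exact hnat n x₁ x₂ y₁ y₂ hx₁ hy₁ hx₂ hy₂ hx hy
  · rw [neg_smul, natCast_zsmul, neg_eq_iff_eq_neg, neg_add] at hx hy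
    have := hnat n (-x₁) (-x₂) (-y₁) (-y₂) (by rw [map_neg, hx₁, neg_zero])
      (by rw [map_neg, hy₁, neg_zero]) (by rw [map_neg, hx₂, neg_zero])
      (by rw [map_neg, hy₂, neg_zero]) hx hy
    simpa using this

/-- An element `v` of the derived subgroup of `R ∩ S` comes from a tensor `t` over the abelianization
of `R ∩ S`, the image of `v - 1` in `R_ab ⊗ S_ab` being the antisymmetrization of `t`. -/
theorem exists_tensor_of_mem_commutator {R S : Subgroup F} {T Q : Type*} [AddCommGroup T] [Group Q]
    (q : ↥(R ⊓ S) →* Q) (ι : Multiplicative T →* Q)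
    (β : Additive (Abelianization ↥(R ⊓ S)) →ₗ[ℤ] Additive (Abelianization ↥(R ⊓ S)) →ₗ[ℤ] T)
    (hβ : ∀ a b, ι (Multiplicative.ofAdd
      (β (Abelianization.addOf a) (Abelianization.addOf b))) = q (elemComm a b))
    (Λ : MonoidAlgebra ℤ F →+ Additive (Abelianization R) ⊗[ℤ] Additive (Abelianization S))
    (hΛ : ∀ (a : R) (b : S), Λ ((MonoidAlgebra.of ℤ F a - 1) * (MonoidAlgebra.of ℤ F b - 1)) =
      Abelianization.addOf a ⊗ₜ Abelianization.addOf b)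
    (hΛ0 : ∀ α ∈ tripleIdeal R S, Λ α = 0)
    (ρ : Additive (Abelianization ↥(R ⊓ S)) →ₗ[ℤ] Additive (Abelianization R))
    (hρ : ∀ a : ↥(R ⊓ S), ρ (Abelianization.addOf a) = Abelianization.addOf ⟨a, a.2.1⟩)
    (σ : Additive (Abelianization ↥(R ⊓ S)) →ₗ[ℤ] Additive (Abelianization S))
    (hσ : ∀ a : ↥(R ⊓ S), σ (Abelianization.addOf a) = Abelianization.addOf ⟨a, a.2.2⟩)
    (v : F) (hv : v ∈ ⁅R ⊓ S, R ⊓ S⁆) :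
    ∃ t : Additive (Abelianization ↥(R ⊓ S)) ⊗[ℤ] Additive (Abelianization ↥(R ⊓ S)),
      ι (Multiplicative.ofAdd (TensorProduct.lift β t)) =
        q ⟨v, Subgroup.commutator_le_self _ hv⟩ ∧
      Λ (MonoidAlgebra.of ℤ F v - 1) =
        TensorProduct.map ρ σ (t - TensorProduct.comm ℤ _ _ t) := by
  -- The cross terms vanish, so `v ↦ Λ (v - 1)` is a homomorphism on the derived subgroup of `R ∩
  -- S`.
  have hΛD : ∀ a ∈ ⁅R ⊓ S, R ⊓ S⁆, ∀ b ∈ ⁅R ⊓ S, R ⊓ S⁆,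
      Λ ((MonoidAlgebra.of ℤ F a - 1) * (MonoidAlgebra.of ℤ F b - 1)) = 0 := fun a ha b hb =>
    hΛ0 _ (mul_mem_triple_of_mem_commutator_left
      (Subgroup.commutator_mono inf_le_left inf_le_left ha) (Subgroup.commutator_le_self _ hb).2)
  have hv' := hv
  rw [Subgroup.commutator_def] at hv'
  induction hv' using Subgroup.closure_induction with
  | mem v h =>
    obtain ⟨a, ha, b, hb, rfl⟩ := h
    -- The inverses translate `⁅a, b⁆ = a b a⁻¹ b⁻¹` into the convention of `elemComm`.
    refine ⟨Abelianization.addOf (⟨a⁻¹, (R ⊓ S).inv_mem ha⟩ : ↥(R ⊓ S)) ⊗ₜ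
      Abelianization.addOf (⟨b⁻¹, (R ⊓ S).inv_mem hb⟩ : ↥(R ⊓ S)), ?_, ?_⟩
    · rw [TensorProduct.lift.tmul, hβ]
      congr 1
      exact Subtype.ext (commutatorElement_eq_elemComm a b).symm
    · have h1 := hΛ0 _ (of_elemComm_sub_one_sub_mem_triple ((R ⊓ S).inv_mem ha) ((R ⊓ S).inv_mem hb))
      have h2 : Λ ((MonoidAlgebra.of ℤ F a⁻¹ - 1) * (MonoidAlgebra.of ℤ F b⁻¹ - 1)) = _ :=
        hΛ ⟨a⁻¹, ((R ⊓ S).inv_mem ha).1⟩ ⟨b⁻¹, ((R ⊓ S).inv_mem hb).2⟩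
      have h3 : Λ ((MonoidAlgebra.of ℤ F b⁻¹ - 1) * (MonoidAlgebra.of ℤ F a⁻¹ - 1)) = _ :=
        hΛ ⟨b⁻¹, ((R ⊓ S).inv_mem hb).1⟩ ⟨a⁻¹, ((R ⊓ S).inv_mem ha).2⟩
      rw [map_sub, sub_eq_zero, map_sub Λ (_ * _), h2, h3] at h1
      rw [commutatorElement_eq_elemComm, h1, TensorProduct.comm_tmul, map_sub,
        TensorProduct.map_tmul, TensorProduct.map_tmul, hρ, hσ, hρ, hσ]
  | one =>
    refine ⟨0, ?_, by simp [MonoidAlgebra.one_def]⟩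
    rw [map_zero, ofAdd_zero, map_one]
    exact (map_one q).symm
  | mul v v' hv1 hv2 ih1 ih2 =>
    rw [← Subgroup.commutator_def] at hv1 hv2
    obtain ⟨t, ht, ht'⟩ := ih1 hv1
    obtain ⟨s, hs, hs'⟩ := ih2 hv2
    refine ⟨t + s, ?_, ?_⟩
    · rw [map_add, ofAdd_add, map_mul, ht, hs, ← map_mul]
      rfl
    · have h1 : MonoidAlgebra.of ℤ F (v * v') - 1 = (MonoidAlgebra.of ℤ F v - 1) *
          (MonoidAlgebra.of ℤ F v' - 1) + (MonoidAlgebra.of ℤ F v - 1) +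
          (MonoidAlgebra.of ℤ F v' - 1) := by
        rw [map_mul]; noncomm_ring
      rw [h1, map_add, map_add, hΛD v hv1 v' hv2, ht', hs', zero_add]
      simp only [map_sub, map_add]
      abel
  | inv v hv1 ih =>
    rw [← Subgroup.commutator_def] at hv1
    obtain ⟨t, ht, ht'⟩ := ih hv1
    refine ⟨-t, ?_, ?_⟩
    · rw [map_neg, ofAdd_neg, map_inv, ht, ← map_inv]
      rfl
    · have h1 : MonoidAlgebra.of ℤ F v⁻¹ - 1 = - ((MonoidAlgebra.of ℤ F v - 1) *
          (MonoidAlgebra.of ℤ F v⁻¹ - 1) + (MonoidAlgebra.of ℤ F v - 1)) := by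
        rw [mul_sub, sub_mul, ← map_mul, mul_inv_cancel, map_one]; noncomm_ring
      rw [h1, map_neg, map_add, hΛD v hv1 v⁻¹ (inv_mem hv1), ht', zero_add]
      simp only [map_sub, map_neg]
      abel

theorem mem_of_sub_one_mem_tripleIdeal (R S : Subgroup F) [R.Normal] [S.Normal] [IsFreeGroup R]
    [IsFreeGroup S] (K : Subgroup F)
    (h₁ : ⁅⁅R, R⁆ ⊓ ⁅S, S⁆, R ⊓ S⁆ ≤ K) (h₂ : ⁅⁅R, R⁆ ⊓ S, ⁅R, R⁆ ⊓ S⁆ ≤ K)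
    (h₃ : ⁅R ⊓ ⁅S, S⁆, R ⊓ ⁅S, S⁆⁆ ≤ K) (h₄ : subgroupW R S ≤ K)
    (hK : K ≤ ⁅R ⊓ S, R ⊓ S⁆) {w : F}
    (hw : MonoidAlgebra.of ℤ F w - 1 ∈ tripleIdeal R S) : w ∈ K := by
  have hwRS : MonoidAlgebra.of ℤ F w - 1 ∈ groupRingIdeal R * groupRingIdeal S :=
    Ideal.mul_mono_left (I := groupRingIdeal R * groupRingIdeal ⊤) (K := groupRingIdeal S)
      Ideal.mul_le_left hw
  have hwS : w ∈ S := mem_of_of_sub_one_mem_groupRingIdeal (Ideal.mul_le_right hwRS)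
  have hwR : w ∈ R := mem_of_of_sub_one_mem_groupRingIdeal (Ideal.mul_le_left hwRS)
  have hwD := mem_commutator_inf_of_sub_one_mem_mul R S ⟨hwR, hwS⟩ hwRS
  have hDD : ⁅⁅R ⊓ S, R ⊓ S⁆, R ⊓ S⁆ ≤ K := (Subgroup.commutator_mono
    (le_inf (Subgroup.commutator_mono inf_le_left inf_le_left)
      (Subgroup.commutator_mono inf_le_right inf_le_right)) le_rfl).trans h₁
  set D := R ⊓ S with hD
  have hcomm : ⁅commutator D, (⊤ : Subgroup D)⁆ ≤ K.subgroupOf D := by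
    rw [Subgroup.subgroupOf, ← Subgroup.map_le_iff_le_comap, Subgroup.map_commutator,
      Subgroup.map_subtype_commutator]
    refine le_trans (Subgroup.commutator_mono le_rfl ?_) hDD
    rintro _ ⟨x, -, rfl⟩
    exact x.2
  -- Normality in `D` comes from `[D', D] ≤ K ≤ D'`: conjugating an element of `K` changes it by an
  -- element of `[D', D]`.
  have hnormal : (K.subgroupOf D).Normal := by
    refine ⟨fun k hk g => ?_⟩
    have hk' : k ∈ commutator D := by
      have := hK hk
      rw [← Subgroup.map_subtype_commutator] at this
      obtain ⟨k', hk', h⟩ := this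
      rwa [← Subtype.ext h]
    have h1 : ⁅k, g⁆ ∈ K.subgroupOf D := hcomm (Subgroup.commutator_mem_commutator hk' trivial)
    have h2 := (K.subgroupOf D).mul_mem ((K.subgroupOf D).inv_mem h1) hk
    simpa [commutatorElement_def, mul_assoc] using h2
  obtain ⟨T, _, ι, β, hι, hβ, halt⟩ := exists_commutator_bilin (K.subgroupOf D) hcomm
  obtain ⟨Λ, hΛ, hΛ0⟩ := exists_addHom_tensor_abelianization R S
  let ρ : Additive (Abelianization D) →ₗ[ℤ] Additive (Abelianization R) :=
    (MonoidHom.toAdditive (Abelianization.map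
      (Subgroup.inclusion (inf_le_left : R ⊓ S ≤ R)))).toIntLinearMap
  let σ : Additive (Abelianization D) →ₗ[ℤ] Additive (Abelianization S) :=
    (MonoidHom.toAdditive (Abelianization.map
      (Subgroup.inclusion (inf_le_right : R ⊓ S ≤ S)))).toIntLinearMap
  have hρ : ∀ a : D, ρ (Abelianization.addOf a) = Abelianization.addOf ⟨a, a.2.1⟩ := fun a => rfl
  have hσ : ∀ a : D, σ (Abelianization.addOf a) = Abelianization.addOf ⟨a, a.2.2⟩ := fun a => rfl
  clear_value ρ σ
  obtain ⟨t, ht, ht'⟩ := exists_tensor_of_mem_commutator (QuotientGroup.mk' (K.subgroupOf D)) ι β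
    hβ Λ hΛ hΛ0 ρ hρ σ hσ w hwD
  have := IsFreeGroup.isTorsionFree_abelianization R
  have := IsFreeGroup.isTorsionFree_abelianization S
  have h0 := LinearMap.lift_eq_zero_of_map_sub_comm_eq_zero ρ σ β halt
    (commutator_bilin_compat K h₁ h₂ h₃ h₄ ρ hρ σ hσ β fun a b c d h => ?_) t
    (by rw [← ht']; exact hΛ0 _ hw)
  · rw [h0, ofAdd_zero, map_one, eq_comm, QuotientGroup.coe_mk', QuotientGroup.eq_one_iff] at ht
    exact ht
  · refine Multiplicative.ofAdd.injective (hι ?_)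
    rw [hβ, hβ, ← mul_inv_eq_one, ← QuotientGroup.mk_inv, ← QuotientGroup.mk_mul,
      QuotientGroup.eq_one_iff]
    exact h

end Main

theorem theorem2 {F : Type*} [Group F] [IsFreeGroup F]
    (R S : Subgroup F) (hR : R.Normal) (hS : S.Normal) :
    groupCapOneAdd (groupRingIdeal R * groupRingIdeal (⊤ : Subgroup F) * groupRingIdeal S) =
      ((⁅⁅R, R⁆ ⊓ ⁅S, S⁆, R ⊓ S⁆ : Subgroup F) : Set F) *
        ((⁅⁅R, R⁆ ⊓ S, ⁅R, R⁆ ⊓ S⁆ : Subgroup F) : Set F) *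
        ((⁅R ⊓ ⁅S, S⁆, R ⊓ ⁅S, S⁆⁆ : Subgroup F) : Set F) *
        (subgroupW R S : Set F) := by
  have hRle : ⁅R, R⁆ ≤ R := Subgroup.commutator_le_left R R
  have hSle : ⁅S, S⁆ ≤ S := Subgroup.commutator_le_left S S
  set N₁ := ⁅⁅R, R⁆ ⊓ ⁅S, S⁆, R ⊓ S⁆ with hN₁
  set N₂ := ⁅⁅R, R⁆ ⊓ S, ⁅R, R⁆ ⊓ S⁆ with hN₂
  set N₃ := ⁅R ⊓ ⁅S, S⁆, R ⊓ ⁅S, S⁆⁆ with hN₃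
  have n₁ : N₁.Normal := by rw [hN₁]; infer_instance
  have n₂ : N₂.Normal := by rw [hN₂]; infer_instance
  have n₃ : N₃.Normal := by rw [hN₃]; infer_instance
  -- The first three factors are normal, so the product of sets is the join of the subgroups, with
  -- no normality needed for `W`.
  rw [← Subgroup.normal_mul, ← Subgroup.normal_mul, ← Subgroup.normal_mul]
  apply Set.Subset.antisymm
  · intro w hw
    refine mem_of_sub_one_mem_tripleIdeal R S (N₁ ⊔ N₂ ⊔ N₃ ⊔ subgroupW R S)
      (le_sup_left.trans (le_sup_left.trans le_sup_left))
      (le_sup_right.trans (le_sup_left.trans le_sup_left)) (le_sup_right.trans le_sup_left)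
      le_sup_right (sup_le (sup_le (sup_le ?_ ?_) ?_) ?_) hw
    · exact Subgroup.commutator_mono (inf_le_inf hRle hSle) le_rfl
    · exact Subgroup.commutator_mono (inf_le_inf hRle le_rfl) (inf_le_inf hRle le_rfl)
    · exact Subgroup.commutator_mono (inf_le_inf le_rfl hSle) (inf_le_inf le_rfl hSle)
    · rw [subgroupW, Subgroup.closure_le]
      rintro _ ⟨x, y, x₁, x₂, y₁, y₂, m, hx, hy, -, -, -, hx₁, -, -, hy₂, rfl⟩
      exact mul_mem (elemComm_mem_commutator ⟨hRle hx₁.1, hx₁.2⟩ hy)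
        (inv_mem (elemComm_mem_commutator hx ⟨hy₂.1, hSle hy₂.2⟩))
  · change ((N₁ ⊔ N₂ ⊔ N₃ ⊔ subgroupW R S : Subgroup F) : Set F) ⊆
      (capOneAddSubgroup (tripleIdeal R S) : Set F)
    rw [SetLike.coe_subset_coe]
    refine sup_le (sup_le (sup_le ?_ ?_) ?_) subgroupW_le_capOneAddSubgroup
    · exact commutator_le_capOneAddSubgroup
        (fun a ha b hb => mul_mem_triple_of_mem_commutator_left ha.1 hb.2)
        (fun a ha b hb => mul_mem_triple_of_mem_commutator_right hb.1 ha.2)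
    · exact commutator_le_capOneAddSubgroup
        (fun a ha b hb => mul_mem_triple_of_mem_commutator_left ha.1 hb.2)
        (fun a ha b hb => mul_mem_triple_of_mem_commutator_left hb.1 ha.2)
    · exact commutator_le_capOneAddSubgroup
        (fun a ha b hb => mul_mem_triple_of_mem_commutator_right ha.1 hb.2)
        (fun a ha b hb => mul_mem_triple_of_mem_commutator_right hb.1 ha.2)
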